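/- **Setting.** Let $q_0=0$ and $q_j=e^{(2j-1)\pi i/4}\in\mathbb C$ for $1\le j\le 4$, and let $K_0$ be the closed square with vertices $q_1,\dots,q_4$. Let $\bm l=(l_k)_{k\ge1}$ be any sequence of odd integers $l_k\ge3$ (not necessarily bounded). For odd $m\ge 3$ let $S_m=\{2nm^{-1}q_j:0\le n\le (m-1)/2,\ 1\le j\le4\}$ and $F^m_w(z)=w+m^{-1}z$ for $w\in S_m$. For a word $w=w_1\cdots w_n\in W_n:=\prod_{k=1}^nS_{l_k}$ put $F_w=F^{l_1}_{w_1}\circ\cdots\circ F^{l_n}_{w_n}$ ($F_w=\mathrm{id}$ for the empty word, $n=0$). The scale-irregular Vicsek set is the compact set $$K=K^{\bm l}=\bigcap_{n\ge1}\bigcup_{w\in W_n}F_w(K_0)\subset\mathbb C ,$$ with the Euclidean metric $d$. Let $\mu$ be the canonical Borel probability measure on $K$, which gives mass $(\#W_n)^{-1}$ to $F_w(K_0)\cap K$ for every $w\in W_n$, i.e. the image of the product of the uniform distributions on the sets $S_{l_k}$ under the coding map $(w_k)_{k\ge1}\mapsto\lim_{n}F_{w_1\cdots w_n}(0)$. For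 $n\ge0$ let $V_n=\bigcup_{w\in W_n}F_w(\{q_0,\dots,q_4\})\subset K$, and write $x\sim_n y$ for $x,y\in V_n$ with $d(x,y)=(l_1\cdots l_n)^{-1}$. For $1<p<\infty$ and $u\in C(K)$ (real-valued continuous functions) let $$\mathcal E_{p,n}(u)=\frac12\Big(\prod_{k=1}^n l_k^{p-1}\Big)\sum_{x,y\in V_n,\ x\sim_n y}|u(x)-u(y)|^p ,\qquad \mathcal F_p=\Big\{u\in C(K):\sup_{n\ge0}\mathcal E_{p,n}(u)<\infty\Big\},$$ and for $u\in\mathcal F_p$ let $\mathcal E_p(u)=\sup_{n\ge 0}\mathcal E_{p,n}(u)$ and $\|u\|_{\mathcal F_p}=\big(\|u\|_{L^p(K,\mu)}^p+\mathcal E_p(u)\big)^{1/p}$. **Theorem.** For every such sequence $\bm l$ and every $1<p<\infty$, the sequence $(\mathcal E_{p,n}(u))_{n\ge0}$ is non-decreasing for every $u\in C(K)$; $\mathcal F_p$ is a linear subspace of $C(K)$, $\mathcal E_p^{1/p}$ is a seminorm on it and $\|\cdot\|_{\mathcal F_p}$ a norm, and: 1. $(\mathcal F_p,\|\cdot\|_{\mathcal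 F_p})$ is a uniformly convex, separable, reflexive Banach space. 2. $uv\in\mathcal F_p$ for all $u,v\in\mathcal F_p$, and $\mathcal E_p(uv)\le 2^{p-1}\big(\|u\|_{C(K)}^p\mathcal E_p(v)+\|v\|_{C(K)}^p\mathcal E_p(u)\big)$, where $\|\cdot\|_{C(K)}$ is the supremum norm. 3. (Regularity) $\mathcal F_p$ is dense in $(C(K),\|\cdot\|_{C(K)})$. 4. (Lipschitz contractivity) For every $u\in\mathcal F_p$ and every $1$-Lipschitz function $\varphi:\mathbb R\to\mathbb R$, $\varphi\circ u\in\mathcal F_p$ and $\mathcal E_p(\varphi\circ u)\le\mathcal E_p(u)$. 5. (Spectral gap) There is a constant $C\ge1$ such that for every $u\in\mathcal F_p$ $$\int_K\Big|u-\int_K u\,d\mu\Big|^p\,d\mu\le C\operatorname{diam}(K)^{p-1}\,\mathcal E_p(u).$$ 6. (Strong locality) If $u,v\in\mathcal F_p$ and $\operatorname{supp}(u)\cap\operatorname{supp}(v-a\mathbf 1_K)=\emptyset$ for some $a\in\mathbb R$, then $\mathcal E_p(u+v)=\mathcal E_p(u)+\mathcal E_p(v)$. -/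

import Mathlib

open MeasureTheory ProbabilityTheory Filter Topology

/-- A sequence of odd integers at least `3`; `l.ratio k` is the integer usually written
`l_{k+1}`, so that the cells of level `k + 1` are smaller than those of level `k` by the
factor `l.ratio k`. -/
structure VicsekScale where
  ratio : ℕ → ℕ
  odd_ratio : ∀ k, Odd (ratio k)
  three_le_ratio : ∀ k, 3 ≤ ratio k

namespace VicsekScale

noncomputable section

/-- The corners `q_1, …, q_4` (here indexed by `0, …, 3`) of the square `K_0`. -/
def corner (j : Fin 4) : ℂ :=
  Complex.exp ((2 * ((j : ℕ) : ℂ) + 1) * (Real.pi : ℂ) * Complex.I / 4)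

/-- The closed square with vertices `q_1, …, q_4`. -/
def square : Set ℂ := convexHull ℝ (Set.range corner)

/-- The translation vectors `2 n q_j / m`, `0 ≤ n ≤ (m - 1) / 2`, for an odd number `m`. -/
def digits (m : ℕ) : Finset ℂ :=
  (Finset.range ((m - 1) / 2 + 1) ×ˢ (Finset.univ : Finset (Fin 4))).image
    fun a => 2 * (a.1 : ℂ) / (m : ℂ) * corner a.2

/-- The contraction `z ↦ w + z / m`. -/
def contraction (m : ℕ) (w z : ℂ) : ℂ := w + z / (m : ℂ)

variable (l : VicsekScale)

/-- Finite words of length `n`. -/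
abbrev Word (n : ℕ) : Type := (k : Fin n) → digits (l.ratio k)

/-- Infinite words. -/
abbrev InfWord : Type := (k : ℕ) → digits (l.ratio k)

/-- The prefix of length `n` of an infinite word. -/
def InfWord.take {l : VicsekScale} (τ : InfWord l) (n : ℕ) : Word l n := fun k => τ k

/-- The composition `F_{w_1} ∘ ⋯ ∘ F_{w_n}` of the contractions along a word. -/
def wordMap : (n : ℕ) → Word l n → ℂ → ℂ
  | 0, _, z => z
  | n + 1, w, z =>
      wordMap n (fun k => w k.castSucc) (contraction (l.ratio n) (w (Fin.last n)) z)

/-- The product `l_1 ⋯ l_n`. -/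
def scale (n : ℕ) : ℕ := ∏ k ∈ Finset.range n, l.ratio k

/-- The scale-irregular Vicsek set. -/
def carrier : Set ℂ := ⋂ n : ℕ, ⋃ w : Word l n, wordMap l n w '' square

/-- The centre and the four corners of the initial square. -/
def baseVertices : Finset ℂ := insert 0 (Finset.univ.image corner)

/-- The vertex set `V_n` in the plane. -/
def planeVertices (n : ℕ) : Finset ℂ :=
  ((Finset.univ : Finset (Word l n)) ×ˢ baseVertices).image fun a => wordMap l n a.1 a.2

/-! ### Basic geometry -/

lemma ratio_pos (k : ℕ) : 0 < l.ratio k := by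
  have := l.three_le_ratio k; omega

instance (k : ℕ) : Nonempty (digits (l.ratio k)) :=
  ⟨⟨2 * ((0 : ℕ) : ℂ) / (l.ratio k : ℂ) * corner 0,
    Finset.mem_image.2 ⟨(0, 0), by simp, rfl⟩⟩⟩

lemma zero_mem_digits (m : ℕ) : (0 : ℂ) ∈ digits m :=
  Finset.mem_image.2 ⟨(0, 0), by simp, by simp⟩

lemma norm_corner (j : Fin 4) : ‖corner j‖ = 1 := by
  have : (2 * ((j : ℕ) : ℂ) + 1) * (Real.pi : ℂ) * Complex.I / 4
      = (((2 * ((j : ℕ) : ℝ) + 1) * Real.pi / 4 : ℝ) : ℂ) * Complex.I := by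
    push_cast; ring
  rw [corner, this, Complex.norm_exp_ofReal_mul_I]

lemma corner_opp : corner 2 = - corner 0 := by
  have : (2 * (((2 : Fin 4) : ℕ) : ℂ) + 1) * (Real.pi : ℂ) * Complex.I / 4
      = (2 * (((0 : Fin 4) : ℕ) : ℂ) + 1) * (Real.pi : ℂ) * Complex.I / 4
        + Real.pi * Complex.I := by
    simp; ring
  rw [corner, this, Complex.exp_add_pi_mul_I, corner]

lemma corner_mem_square (j : Fin 4) : corner j ∈ square :=
  subset_convexHull ℝ _ ⟨j, rfl⟩

lemma convex_square : Convex ℝ square := convex_convexHull ℝ _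

lemma isClosed_square : IsClosed square :=
  (Set.finite_range corner).isClosed_convexHull ℝ

lemma zero_mem_square : (0 : ℂ) ∈ square := by
  have h := convex_square (corner_mem_square 0) (corner_mem_square 2)
    (by norm_num : (0 : ℝ) ≤ 1 / 2) (by norm_num : (0 : ℝ) ≤ 1 / 2) (by norm_num)
  rw [corner_opp] at h
  simpa using h

lemma norm_le_of_mem_square {z : ℂ} (hz : z ∈ square) : ‖z‖ ≤ 1 := by
  have h : square ⊆ Metric.closedBall (0 : ℂ) 1 :=
    convexHull_min (by rintro _ ⟨j, rfl⟩; simp [norm_corner]) (convex_closedBall _ _)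
  simpa using h hz

lemma baseVertices_subset : ∀ z ∈ baseVertices, z ∈ square := by
  intro z hz
  rcases Finset.mem_insert.1 hz with rfl | hz
  · exact zero_mem_square
  · obtain ⟨j, -, rfl⟩ := Finset.mem_image.1 hz
    exact corner_mem_square j

lemma contraction_mem_square (k : ℕ) {w z : ℂ} (hw : w ∈ digits (l.ratio k))
    (hz : z ∈ square) : contraction (l.ratio k) w z ∈ square := by
  obtain ⟨⟨n, j⟩, hn, rfl⟩ := Finset.mem_image.1 hw
  have hn' : n ≤ (l.ratio k - 1) / 2 := by
    simp only [Finset.mem_product, Finset.mem_range, Finset.mem_univ, and_true] at hn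
    omega
  have hpos := l.ratio_pos k
  have hle : 2 * n + 1 ≤ l.ratio k := by omega
  have hle' : (2 * n + 1 : ℝ) ≤ l.ratio k := by exact_mod_cast hle
  have hpos' : (0 : ℝ) < l.ratio k := by exact_mod_cast hpos
  have hfirst := convex_square (corner_mem_square j) hz
    (a := 2 * n / (2 * n + 1)) (b := 1 / (2 * n + 1)) (by positivity) (by positivity)
    (by field_simp)
  have := convex_square hfirst zero_mem_square
    (a := (2 * n + 1) / l.ratio k) (b := 1 - (2 * n + 1) / l.ratio k) (by positivity)
    (by rw [sub_nonneg, div_le_one hpos']; exact hle') (by ring)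
  convert this using 1
  have h1 : (2 * (n : ℂ) + 1) ≠ 0 := by exact_mod_cast Nat.succ_ne_zero (2 * n)
  have h2 : (l.ratio k : ℂ) ≠ 0 := by exact_mod_cast hpos.ne'
  simp only [contraction, Complex.real_smul]
  push_cast
  field_simp
  ring

lemma exists_contraction_eq (k : ℕ) {z : ℂ} (hz : z ∈ baseVertices) :
    ∃ w ∈ digits (l.ratio k), contraction (l.ratio k) w z = z := by
  rcases Finset.mem_insert.1 hz with rfl | hz
  · exact ⟨0, zero_mem_digits _, by simp [contraction]⟩
  · obtain ⟨j, -, rfl⟩ := Finset.mem_image.1 hz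
    refine ⟨_, Finset.mem_image.2 ⟨((l.ratio k - 1) / 2, j), by simp, rfl⟩, ?_⟩
    have hpos := l.ratio_pos k
    obtain ⟨m, hm⟩ := l.odd_ratio k
    have h2 : (l.ratio k : ℂ) ≠ 0 := by exact_mod_cast hpos.ne'
    have h3 : (l.ratio k - 1) / 2 = m := by omega
    have h4 : (l.ratio k : ℂ) = 2 * m + 1 := by exact_mod_cast hm
    simp only [contraction, h3]
    rw [h4] at h2 ⊢
    field_simp

lemma wordMap_sub (n : ℕ) (w : Word l n) (x y : ℂ) :
    wordMap l n w x - wordMap l n w y = (x - y) / (l.scale n : ℂ) := by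
  induction n generalizing x y with
  | zero => simp [wordMap, scale]
  | succ n ih =>
    rw [wordMap, wordMap, ih, scale, scale, Finset.prod_range_succ]
    have h2 : (l.ratio n : ℂ) ≠ 0 := by exact_mod_cast (l.ratio_pos n).ne'
    simp only [contraction]
    push_cast
    field_simp
    ring

lemma continuous_wordMap (n : ℕ) (w : Word l n) : Continuous (wordMap l n w) := by
  have : wordMap l n w = fun x => wordMap l n w 0 + x / (l.scale n : ℂ) := by
    funext x
    have := wordMap_sub l n w x 0
    rw [sub_zero] at this
    rw [← this]; ring
  rw [this]
  fun_prop

lemma isClosed_cell (n : ℕ) (w : Word l n) : IsClosed (wordMap l n w '' square) :=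
  ((((Set.finite_range corner).isCompact_convexHull ℝ).image
    (continuous_wordMap l n w))).isClosed

lemma three_pow_le_scale (n : ℕ) : 3 ^ n ≤ l.scale n := by
  rw [scale, ← Finset.card_range n, ← Finset.prod_const, Finset.card_range]
  exact Finset.prod_le_prod' fun k _ => l.three_le_ratio k

lemma dist_le_of_mem_cell {n : ℕ} {w : Word l n} {x y : ℂ}
    (hx : x ∈ wordMap l n w '' square) (hy : y ∈ wordMap l n w '' square) :
    dist x y ≤ 2 / 3 ^ n := by
  obtain ⟨a, ha, rfl⟩ := hx
  obtain ⟨b, hb, rfl⟩ := hy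
  rw [dist_eq_norm, wordMap_sub, norm_div, Complex.norm_natCast]
  have h1 : ‖a - b‖ ≤ 2 := (norm_sub_le _ _).trans (by
    have := norm_le_of_mem_square ha; have := norm_le_of_mem_square hb; linarith)
  have h2 : (3 : ℝ) ^ n ≤ l.scale n := by exact_mod_cast l.three_pow_le_scale n
  gcongr

lemma cell_antitone (τ : InfWord l) :
    Antitone fun n => wordMap l n (τ.take n) '' square := by
  refine antitone_nat_of_succ_le fun n => ?_
  rintro _ ⟨z, hz, rfl⟩
  exact ⟨_, contraction_mem_square l n (τ n).2 hz, rfl⟩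

/-- Extension of a finite word by the word `τ`. -/
def Word.extend {l : VicsekScale} {n : ℕ} (w : Word l n) (τ : InfWord l) : InfWord l :=
  fun k => if h : k < n then w ⟨k, h⟩ else τ k

lemma Word.take_extend {n : ℕ} (w : Word l n) (τ : InfWord l) :
    (w.extend τ).take n = w := by
  funext k
  simp [InfWord.take, Word.extend]

lemma planeVertices_subset (n : ℕ) : ∀ z ∈ planeVertices l n, z ∈ carrier l := by
  intro z hz
  obtain ⟨⟨w, q⟩, hq, rfl⟩ := Finset.mem_image.1 hz
  replace hq : q ∈ baseVertices := (Finset.mem_product.1 hq).2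
  choose s hs hsq using fun k => exists_contraction_eq l k hq
  set τ : InfWord l := w.extend fun k => ⟨s k, hs k⟩ with hτ
  have key : ∀ m, wordMap l (n + m) (τ.take (n + m)) q = wordMap l n w q := by
    intro m
    induction m with
    | zero => simp only [Nat.add_zero]; rw [hτ, Word.take_extend]
    | succ m ih =>
      rw [← ih, ← Nat.add_assoc, wordMap]
      have : ((τ.take (n + m + 1) (Fin.last (n + m)) : digits _) : ℂ) = s (n + m) := by
        simp [InfWord.take, hτ, Word.extend]
      rw [this, hsq]
      rfl
  refine Set.mem_iInter.2 fun m => Set.mem_iUnion.2 ⟨τ.take m, ?_⟩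
  refine cell_antitone l τ (Nat.le_add_left m n) ?_
  exact ⟨q, baseVertices_subset q hq, key m⟩

/-! ### The coding map and the measure -/

lemma cauchySeq_code (τ : InfWord l) :
    CauchySeq fun n => wordMap l n (τ.take n) 0 := by
  refine cauchySeq_of_le_geometric (1 / 3) 2 (by norm_num) fun n => ?_
  have h := dist_le_of_mem_cell l (n := n) (w := τ.take n)
    ⟨0, zero_mem_square, rfl⟩
    (cell_antitone l τ n.le_succ ⟨0, zero_mem_square, rfl⟩)
  simpa [div_eq_mul_inv] using h

/-- The limit of the centres of the cells along an infinite word, which is the only point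
that is common to all these cells. -/
def codePoint (τ : InfWord l) : ℂ := limUnder atTop fun n => wordMap l n (τ.take n) 0

lemma tendsto_codePoint (τ : InfWord l) :
    Tendsto (fun n => wordMap l n (τ.take n) 0) atTop (𝓝 (codePoint l τ)) :=
  (cauchySeq_code l τ).tendsto_limUnder

lemma codePoint_mem_cell (τ : InfWord l) (n : ℕ) :
    codePoint l τ ∈ wordMap l n (τ.take n) '' square :=
  (isClosed_cell l n _).mem_of_tendsto (tendsto_codePoint l τ)
    (eventually_atTop.2 ⟨n, fun _ hm => cell_antitone l τ hm ⟨0, zero_mem_square, rfl⟩⟩)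

lemma codePoint_mem_carrier (τ : InfWord l) : codePoint l τ ∈ carrier l :=
  Set.mem_iInter.2 fun n => Set.mem_iUnion.2 ⟨_, codePoint_mem_cell l τ n⟩

/-- The coding map from infinite words onto the Vicsek set. -/
def coding (τ : InfWord l) : carrier l := ⟨codePoint l τ, codePoint_mem_carrier l τ⟩

lemma measurable_wordMap (n : ℕ) : Measurable fun τ : InfWord l =>
    wordMap l n (τ.take n) 0 := by
  have : (fun τ : InfWord l => wordMap l n (τ.take n) 0)
      = (fun w : Word l n => wordMap l n w 0) ∘ fun τ : InfWord l => τ.take n := rfl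
  rw [this]
  refine (measurable_of_finite _).comp ?_
  exact measurable_pi_lambda _ fun k => measurable_pi_apply _

lemma measurable_coding : Measurable (coding l) := by
  refine Measurable.subtype_mk ?_
  exact measurable_of_tendsto_metrizable (fun n => measurable_wordMap l n)
    (tendsto_pi_nhds.2 fun τ => tendsto_codePoint l τ)

/-- The law of an infinite word with independent, uniformly distributed letters. -/
def wordMeasure : Measure (InfWord l) :=
  Measure.infinitePi fun k => uniformOn (Set.univ : Set (digits (l.ratio k)))

instance : IsProbabilityMeasure (wordMeasure l) := by
  unfold wordMeasure; infer_instance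

/-- The canonical Borel probability measure on the Vicsek set: the image under the coding map
of the measure on infinite words that gives equal mass to all words of the same length. -/
def measure : Measure (carrier l) := (wordMeasure l).map (coding l)

instance : IsProbabilityMeasure (measure l) :=
  Measure.isProbabilityMeasure_map (measurable_coding l).aemeasurable

instance : CompactSpace (carrier l) := by
  refine isCompact_iff_compactSpace.1 ?_
  refine Metric.isCompact_of_isClosed_isBounded
    (isClosed_iInter fun n => isClosed_iUnion_of_finite fun w => isClosed_cell l n w) ?_
  refine Metric.isBounded_closedBall.subset (t := Metric.closedBall (0 : ℂ) 1) fun z hz => ?_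
  obtain ⟨w, y, hy, rfl⟩ := Set.mem_iUnion.1 (Set.mem_iInter.1 hz 0)
  simpa [wordMap] using norm_le_of_mem_square hy

instance : Measure.IsOpenPosMeasure (measure l) := by
  refine ⟨fun U hU ⟨x, hx⟩ h0 => ?_⟩
  obtain ⟨r, hr, hball⟩ := Metric.isOpen_iff.1 hU x hx
  obtain ⟨n, hn⟩ := exists_pow_lt_of_lt_one (show 0 < r / 2 by positivity)
    (by norm_num : (1 / 3 : ℝ) < 1)
  obtain ⟨w, hw⟩ := Set.mem_iUnion.1 (Set.mem_iInter.1 x.2 n)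
  set A : Set (InfWord l) := {τ | τ.take n = w}
  have hA : A ⊆ coding l ⁻¹' U := by
    intro τ hτ
    refine hball ?_
    have h1 : codePoint l τ ∈ wordMap l n w '' square := by
      have := codePoint_mem_cell l τ n
      rwa [show τ.take n = w from hτ] at this
    have h2 := dist_le_of_mem_cell l h1 hw
    refine lt_of_le_of_lt (show dist (coding l τ) x ≤ _ from h2) ?_
    rw [one_div, inv_pow] at hn
    rw [div_eq_mul_inv]; linarith
  rw [measure, Measure.map_apply (measurable_coding l) hU.measurableSet] at h0
  have hA0 : wordMeasure l A = 0 := measure_mono_null hA h0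
  let t : (k : ℕ) → Set (digits (l.ratio k)) := fun k =>
    if h : k < n then {w ⟨k, h⟩} else Set.univ
  have hAt : A = Set.pi (Finset.range n : Set ℕ) t := by
    ext τ
    simp only [A, Set.mem_ofPred_eq, Set.mem_pi, Finset.coe_range, Set.mem_Iio]
    constructor
    · rintro rfl k hk
      simp [t, hk, InfWord.take]
    · intro h
      funext k
      simpa [t, InfWord.take] using h k k.2
  rw [hAt, wordMeasure, Measure.infinitePi_pi _ (fun i _ => (Set.toFinite _).measurableSet),
    Finset.prod_eq_zero_iff] at hA0
  obtain ⟨k, hk, hk0⟩ := hA0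
  rw [Finset.mem_range] at hk
  rw [show t k = {w ⟨k, hk⟩} by simp [t, hk], uniformOn_univ] at hk0
  simp at hk0

/-! ### Discrete energies and the `p`-energy -/

open Classical in
/-- The vertex set `V_n`, as a set of points of the Vicsek set, in which it is contained. -/
def vertices (n : ℕ) : Finset (carrier l) :=
  (planeVertices l n).subtype fun z => z ∈ carrier l

open Classical in
/-- The ordered pairs of adjacent vertices of level `n`, i.e. those at Euclidean distance
`(l_1 ⋯ l_n)⁻¹`. Every edge occurs twice, once in each direction. -/
def edges (n : ℕ) : Finset (carrier l × carrier l) :=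
  (vertices l n ×ˢ vertices l n).filter fun e => dist e.1 e.2 = (l.scale n : ℝ)⁻¹

/-- The `p`-energy on the graph of level `n`. -/
def discreteEnergy (p : ℝ) (n : ℕ) (u : C(carrier l, ℝ)) : ℝ :=
  1 / 2 * (∏ k ∈ Finset.range n, (l.ratio k : ℝ) ^ (p - 1)) *
    ∑ e ∈ edges l n, |u e.1 - u e.2| ^ p

/-- The `p`-energy, the supremum of the discrete energies. It is only meaningful on functions
with bounded discrete energies, i.e. on `energyDomain`. -/
def energy (p : ℝ) (u : C(carrier l, ℝ)) : ℝ := ⨆ n : ℕ, discreteEnergy l p n u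

variable {l} {p : ℝ}

lemma discreteEnergy_nonneg (n : ℕ) (u : C(carrier l, ℝ)) : 0 ≤ discreteEnergy l p n u := by
  unfold discreteEnergy; positivity

lemma discreteEnergy_smul (n : ℕ) (c : ℝ) (u : C(carrier l, ℝ)) :
    discreteEnergy l p n (c • u) = |c| ^ p * discreteEnergy l p n u := by
  have : ∀ e : carrier l × carrier l,
      |(c • u) e.1 - (c • u) e.2| ^ p = |c| ^ p * |u e.1 - u e.2| ^ p := by
    intro e
    rw [← Real.mul_rpow (abs_nonneg _) (abs_nonneg _), ← abs_mul]
    simp [mul_sub]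
  simp only [discreteEnergy, this, ← Finset.mul_sum]
  ring

lemma discreteEnergy_add (hp : 1 < p) (n : ℕ) (u v : C(carrier l, ℝ)) :
    discreteEnergy l p n (u + v) ^ (1 / p) ≤
      discreteEnergy l p n u ^ (1 / p) + discreteEnergy l p n v ^ (1 / p) := by
  have h := Real.Lp_add_le (edges l n) (fun e => u e.1 - u e.2) (fun e => v e.1 - v e.2) hp.le
  have hw : 0 ≤ 1 / 2 * (∏ k ∈ Finset.range n, (l.ratio k : ℝ) ^ (p - 1)) := by positivity
  simp only [discreteEnergy]
  rw [Real.mul_rpow hw (by positivity), Real.mul_rpow hw (by positivity),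
    Real.mul_rpow hw (by positivity), ← mul_add]
  refine mul_le_mul_of_nonneg_left ?_ (by positivity)
  refine le_trans (le_of_eq ?_) h
  congr 1
  refine Finset.sum_congr rfl fun e _ => ?_
  congr 2
  simp; ring

lemma energy_nonneg (u : C(carrier l, ℝ)) : 0 ≤ energy l p u :=
  Real.iSup_nonneg fun n => discreteEnergy_nonneg n u

lemma bddAbove_add (hp : 1 < p) {u v : C(carrier l, ℝ)}
    (hu : BddAbove (Set.range fun n => discreteEnergy l p n u))
    (hv : BddAbove (Set.range fun n => discreteEnergy l p n v)) (n : ℕ) :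
    discreteEnergy l p n (u + v) ≤ (energy l p u ^ (1 / p) + energy l p v ^ (1 / p)) ^ p := by
  have hp0 : 0 < p := by linarith
  have h1 : discreteEnergy l p n u ≤ energy l p u := le_ciSup hu n
  have h2 : discreteEnergy l p n v ≤ energy l p v := le_ciSup hv n
  have h := discreteEnergy_add hp n u v
  have h3 : discreteEnergy l p n (u + v) ^ (1 / p) ≤
      energy l p u ^ (1 / p) + energy l p v ^ (1 / p) := by
    refine h.trans (add_le_add ?_ ?_)
    · exact Real.rpow_le_rpow (discreteEnergy_nonneg n u) h1 (by positivity)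
    · exact Real.rpow_le_rpow (discreteEnergy_nonneg n v) h2 (by positivity)
  have h4 := Real.rpow_le_rpow (Real.rpow_nonneg (discreteEnergy_nonneg n (u + v)) _) h3 hp0.le
  rwa [← Real.rpow_mul (discreteEnergy_nonneg n _), one_div_mul_cancel hp0.ne',
    Real.rpow_one] at h4

lemma energy_smul (c : ℝ) (u : C(carrier l, ℝ)) :
    energy l p (c • u) = |c| ^ p * energy l p u := by
  simp only [energy, discreteEnergy_smul]
  exact (Real.mul_iSup_of_nonneg (by positivity) _).symm

variable (l p)

/-- The domain of the `p`-energy: the continuous functions with bounded discrete energies. -/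
def energyDomain [hp : Fact (1 < p)] : Submodule ℝ C(carrier l, ℝ) where
  carrier := {u | BddAbove (Set.range fun n => discreteEnergy l p n u)}
  zero_mem' := by
    have hp0 : p ≠ 0 := by linarith [hp.out]
    refine ⟨0, ?_⟩
    rintro _ ⟨n, rfl⟩
    simp [discreteEnergy, Real.zero_rpow hp0]
  add_mem' := by
    intro u v hu hv
    refine ⟨(energy l p u ^ (1 / p) + energy l p v ^ (1 / p)) ^ p, ?_⟩
    rintro _ ⟨n, rfl⟩
    exact bddAbove_add hp.out hu hv n
  smul_mem' := by
    intro c u hu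
    refine ⟨|c| ^ p * energy l p u, ?_⟩
    rintro _ ⟨n, rfl⟩
    simp only [discreteEnergy_smul]
    exact mul_le_mul_of_nonneg_left (le_ciSup hu n) (by positivity)

/-- The space `F_p`: the vector space `energyDomain`, to be normed by
`(‖u‖_{L^p}^p + E_p(u))^{1/p}` instead of the uniform norm. -/
def Sobolev [Fact (1 < p)] : Type := energyDomain l p

variable [hp : Fact (1 < p)]

instance : AddCommGroup (Sobolev l p) := inferInstanceAs (AddCommGroup (energyDomain l p))

instance : Module ℝ (Sobolev l p) := inferInstanceAs (Module ℝ (energyDomain l p))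

variable {l p} in
/-- The continuous function underlying an element of `F_p`. -/
def Sobolev.toFun (u : Sobolev l p) : C(carrier l, ℝ) := Subtype.val (u : energyDomain l p)

instance : Norm (Sobolev l p) :=
  ⟨fun u => ((∫ x, |u.toFun x| ^ p ∂(measure l)) + energy l p u.toFun) ^ (1 / p)⟩

variable {l p}

lemma energy_add (u v : Sobolev l p) :
    energy l p (u.toFun + v.toFun) ^ (1 / p) ≤
      energy l p u.toFun ^ (1 / p) + energy l p v.toFun ^ (1 / p) := by
  have hp0 : 0 < p := by linarith [hp.out]
  have h : energy l p (u.toFun + v.toFun) ≤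
      (energy l p u.toFun ^ (1 / p) + energy l p v.toFun ^ (1 / p)) ^ p :=
    ciSup_le (bddAbove_add hp.out u.2 v.2)
  have h0 : 0 ≤ energy l p u.toFun ^ (1 / p) + energy l p v.toFun ^ (1 / p) :=
    add_nonneg (Real.rpow_nonneg (energy_nonneg _) _) (Real.rpow_nonneg (energy_nonneg _) _)
  have h1 := Real.rpow_le_rpow (energy_nonneg _) h (by positivity : 0 ≤ 1 / p)
  rwa [← Real.rpow_mul h0, mul_one_div_cancel hp0.ne', Real.rpow_one] at h1

lemma integral_add_le (u v : C(carrier l, ℝ)) :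
    (∫ x, |(u + v) x| ^ p ∂(measure l)) ^ (1 / p) ≤
      (∫ x, |u x| ^ p ∂(measure l)) ^ (1 / p) + (∫ x, |v x| ^ p ∂(measure l)) ^ (1 / p) := by
  have hp0 : 0 < p := by linarith [hp.out]
  have hne : ENNReal.ofReal p ≠ 0 := by simpa using hp0
  have hmem : ∀ w : C(carrier l, ℝ), MemLp w (ENNReal.ofReal p) (measure l) := fun w =>
    w.continuous.memLp_of_hasCompactSupport (HasCompactSupport.of_compactSpace _)
  have heq : ∀ w : C(carrier l, ℝ), (∫ x, |w x| ^ p ∂(measure l)) ^ (1 / p)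
      = (eLpNorm w (ENNReal.ofReal p) (measure l)).toReal := by
    intro w
    rw [(hmem w).eLpNorm_eq_integral_rpow_norm hne ENNReal.ofReal_ne_top,
      ENNReal.toReal_ofReal hp0.le, ENNReal.toReal_ofReal (by positivity), one_div]
    rfl
  rw [heq, heq, heq, ← ENNReal.toReal_add (hmem u).eLpNorm_ne_top (hmem v).eLpNorm_ne_top]
  refine ENNReal.toReal_mono
    (ENNReal.add_ne_top.2 ⟨(hmem u).eLpNorm_ne_top, (hmem v).eLpNorm_ne_top⟩) ?_
  rw [ContinuousMap.coe_add]
  exact eLpNorm_add_le (hmem u).1 (hmem v).1 (by simpa using hp.out.le)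

lemma minkowski_two {a b c d : ℝ} (ha : 0 ≤ a) (hb : 0 ≤ b) (hc : 0 ≤ c) (hd : 0 ≤ d) :
    ((a + b) ^ p + (c + d) ^ p) ^ (1 / p) ≤
      (a ^ p + c ^ p) ^ (1 / p) + (b ^ p + d ^ p) ^ (1 / p) := by
  have h := Real.Lp_add_le_of_nonneg (s := (Finset.univ : Finset (Fin 2))) (f := ![a, c])
    (g := ![b, d]) hp.out.le (by simp [Fin.forall_fin_two, ha, hc])
    (by simp [Fin.forall_fin_two, hb, hd])
  simpa [Fin.sum_univ_two] using h

lemma Sobolev.norm_def (u : Sobolev l p) :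
    ‖u‖ = ((∫ x, |u.toFun x| ^ p ∂(measure l)) + energy l p u.toFun) ^ (1 / p) := rfl

variable (l p) in
lemma Sobolev.core : NormedSpace.Core ℝ (Sobolev l p) := by
  have hp0 : 0 < p := by linarith [hp.out]
  have hI : ∀ u : C(carrier l, ℝ), 0 ≤ ∫ x, |u x| ^ p ∂(measure l) := fun u =>
    integral_nonneg fun x => by positivity
  have hpow : ∀ a : ℝ, 0 ≤ a → (a ^ (1 / p)) ^ p = a := fun a ha => by
    rw [← Real.rpow_mul ha, one_div_mul_cancel hp0.ne', Real.rpow_one]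
  refine { norm_nonneg := fun u => ?_, norm_smul := fun c u => ?_,
           norm_triangle := fun u v => ?_, norm_eq_zero_iff := fun u => ⟨fun h => ?_, ?_⟩ }
  · exact Real.rpow_nonneg (add_nonneg (hI _) (energy_nonneg _)) _
  · have h1 : (c • u).toFun = c • u.toFun := rfl
    have h2 : (∫ x, |(c • u.toFun) x| ^ p ∂(measure l))
        = |c| ^ p * ∫ x, |u.toFun x| ^ p ∂(measure l) := by
      rw [← integral_const_mul]
      congr 1
      funext x
      rw [← Real.mul_rpow (abs_nonneg _) (abs_nonneg _), ← abs_mul]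
      rfl
    rw [norm_def, norm_def, h1, h2, energy_smul, ← mul_add,
      Real.mul_rpow (by positivity) (add_nonneg (hI _) (energy_nonneg _)),
      ← Real.rpow_mul (abs_nonneg c), mul_one_div_cancel hp0.ne', Real.rpow_one,
      Real.norm_eq_abs]
  · have h := minkowski_two (p := p) (Real.rpow_nonneg (hI u.toFun) (1 / p))
      (Real.rpow_nonneg (hI v.toFun) (1 / p))
      (Real.rpow_nonneg (energy_nonneg (l := l) (p := p) u.toFun) (1 / p))
      (Real.rpow_nonneg (energy_nonneg (l := l) (p := p) v.toFun) (1 / p))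
    rw [hpow _ (hI _), hpow _ (hI _), hpow _ (energy_nonneg _), hpow _ (energy_nonneg _)] at h
    refine le_trans ?_ h
    have h1 : (u + v).toFun = u.toFun + v.toFun := rfl
    rw [norm_def, h1]
    refine Real.rpow_le_rpow (add_nonneg (hI _) (energy_nonneg _)) ?_ (by positivity)
    refine add_le_add ?_ ?_
    · have := Real.rpow_le_rpow (Real.rpow_nonneg (hI _) _)
        (integral_add_le (p := p) u.toFun v.toFun) hp0.le
      rwa [hpow _ (hI _)] at this
    · have := Real.rpow_le_rpow (Real.rpow_nonneg (energy_nonneg _) _) (energy_add u v) hp0.le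
      rwa [hpow _ (energy_nonneg _)] at this
  · rw [norm_def, Real.rpow_eq_zero (add_nonneg (hI _) (energy_nonneg _)) (by positivity)] at h
    have h0 : ∫ x, |u.toFun x| ^ p ∂(measure l) = 0 := by
      linarith [hI u.toFun, energy_nonneg (l := l) (p := p) u.toFun]
    have hc : Continuous fun x => |u.toFun x| ^ p :=
      (u.toFun.continuous.abs).rpow_const fun _ => Or.inr hp0.le
    have hint : Integrable (fun x => |u.toFun x| ^ p) (measure l) :=
      hc.integrable_of_hasCompactSupport (HasCompactSupport.of_compactSpace _)
    rw [integral_eq_zero_iff_of_nonneg (fun x => by positivity) hint] at h0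
    have h1 := (Continuous.ae_eq_iff_eq (measure l) hc continuous_const).1 h0
    refine Subtype.ext (ContinuousMap.ext fun x => ?_)
    have h2 := congrFun h1 x
    exact abs_eq_zero.1 ((Real.rpow_eq_zero (abs_nonneg _) hp0.ne').1 h2)
  · rintro rfl
    have h1 : (0 : Sobolev l p).toFun = (0 : ℝ) • (0 : C(carrier l, ℝ)) := by
      rw [zero_smul]; rfl
    rw [norm_def, h1, energy_smul]
    simp [Real.zero_rpow hp0.ne', Real.zero_rpow (inv_ne_zero hp0.ne')]

instance : NormedAddCommGroup (Sobolev l p) := NormedAddCommGroup.ofCore (Sobolev.core l p)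

instance : NormedSpace ℝ (Sobolev l p) := NormedSpace.ofCore (Sobolev.core l p)

end

end VicsekScale

/-! Everything rests on the tree structure. In lattice coordinates every edge of level `n` joins the
centre of exactly one cell to one of its corners (`sum_edges`), so the discrete energy is a weighted
sum of star energies over cells. The segment from a centre to a corner is subdivided into `l.ratio
n` edges of the next level. Hölder's inequality along it costs the factor `(l.ratio n) ^ (p - 1)`,
which is exactly the renormalisation, and monotonicity follows.

The same path estimate inside one cell of level `n`, whose energy carries the weight `(l.scale n) ^
(p - 1) ≥ 3 ^ (n * (p - 1))`, bounds the increments between successive centres by a geometric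
sequence. Hence the oscillation is at most a constant times `energy ^ (1 / p)`
(`exists_abs_sub_le`). This gives the spectral gap and an embedding into the uniform norm.
Completeness follows because the energy is a supremum of uniformly continuous-in-the-limit
quantities: each discrete energy is continuous for uniform convergence.

Uniform convexity comes from one scalar inequality (`exists_abs_half_sub_rpow_le`), which is summed
over edges, integrated over the set and passed to the limit in the level. Reflexivity is then
Milman–Pettis. For separability, uniform convergence together with convergence of norms implies
convergence in norm (`Sobolev.exists_norm_sub_lt`), so a countable set dense for the pair (function,
`p`-th power of the norm) is dense.

Density needs many functions of finite energy. In each cell of level `n`, interpolate linearly along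
the two axes and make the function constant on every branch leaving an axis. The projection
collapsing the branches is Lipschitz (`exists_lipschitz_projection`), so the interpolation is too.
At level `n + k` only the `O(l.scale (n + k))` cells centred on an axis contribute, each of them
`O((l.scale (n + k)) ^ (-p))`, and the renormalised sum stays bounded.

Products and contractions are treated edge by edge; locality holds because short edges cannot see
two separated supports at once. -/

/-! ### Convexity of the `p`-th power and uniform convexity -/

lemma abs_midpoint_rpow_le {p : ℝ} (hp : 1 < p) (a b : ℝ) :
    |(a + b) / 2| ^ p ≤ (|a| ^ p + |b| ^ p) / 2 := by
  have h := (convexOn_rpow hp.le).2 (abs_nonneg a) (abs_nonneg b)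
    (by norm_num : (0 : ℝ) ≤ 1 / 2) (by norm_num : (0 : ℝ) ≤ 1 / 2) (by norm_num)
  simp only [smul_eq_mul] at h
  refine (Real.rpow_le_rpow (abs_nonneg _) ?_ (by linarith)).trans (h.trans_eq (by ring))
  rw [abs_div, abs_two]
  linarith [abs_add_le a b]

/-- Strict convexity of `t ^ p` on the half-line settles `|a| ≠ |b|`. In the remaining case `a = -b
≠ 0`, and the midpoint vanishes. -/
lemma abs_midpoint_rpow_lt {p : ℝ} (hp : 1 < p) {a b : ℝ} (hab : a ≠ b) :
    |(a + b) / 2| ^ p < (|a| ^ p + |b| ^ p) / 2 := by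
  have hp0 : 0 < p := by linarith
  by_cases h : |a| = |b|
  · rcases abs_eq_abs.1 h with h | h
    · exact absurd h hab
    · have hb : b ≠ 0 := by rintro rfl; simp at h; exact hab h
      have : 0 < |b| ^ p := Real.rpow_pos_of_pos (abs_pos.2 hb) _
      subst h
      simp only [neg_add_cancel, zero_div, abs_zero, Real.zero_rpow hp0.ne', abs_neg]
      linarith
  · have h := (strictConvexOn_rpow hp).2 (abs_nonneg a) (abs_nonneg b) h
      (by norm_num : (0 : ℝ) < 1 / 2) (by norm_num : (0 : ℝ) < 1 / 2) (by norm_num)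
    simp only [smul_eq_mul] at h
    refine (Real.rpow_le_rpow (abs_nonneg _) ?_ hp0.le).trans_lt (h.trans_eq (by ring))
    rw [abs_div, abs_two]
    linarith [abs_add_le a b]

/-- A homogeneous quantitative form of the strict convexity of `|·| ^ p`. -/
lemma exists_abs_half_sub_rpow_le {p : ℝ} (hp : 1 < p) {ε : ℝ} (hε : 0 < ε) :
    ∃ C : ℝ, 0 < C ∧ ∀ a b : ℝ, |(a - b) / 2| ^ p ≤
      ε * ((|a| ^ p + |b| ^ p) / 2) + C * ((|a| ^ p + |b| ^ p) / 2 - |(a + b) / 2| ^ p) := by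
  have hp0 : 0 < p := by linarith
  set G : ℝ × ℝ → ℝ := fun x => (|x.1| ^ p + |x.2| ^ p) / 2 - |(x.1 + x.2) / 2| ^ p
  have hG : Continuous G := by
    have h : ∀ f : ℝ × ℝ → ℝ, Continuous f → Continuous fun x => |f x| ^ p := fun f hf =>
      hf.abs.rpow_const fun _ => Or.inr hp0.le
    exact (((h _ continuous_fst).add (h _ continuous_snd)).div_const 2).sub
      (h _ ((continuous_fst.add continuous_snd).div_const 2))
  -- Outside `S` the `ε`-term alone dominates. On the compact set `S` one has `a ≠ b`, so the
  -- convexity defect `G` has a positive minimum `δ`, while the left side is at most `1`; this gives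
  -- `C = 1 / δ`.
  set S : Set (ℝ × ℝ) := Metric.sphere 0 1 ∩
    {x | ε * ((|x.1| ^ p + |x.2| ^ p) / 2) ≤ |(x.1 - x.2) / 2| ^ p}
  have hS : IsCompact S := by
    refine (isCompact_sphere _ _).inter_right (isClosed_le ?_ ?_)
    · have h : ∀ f : ℝ × ℝ → ℝ, Continuous f → Continuous fun x => |f x| ^ p := fun f hf =>
        hf.abs.rpow_const fun _ => Or.inr hp0.le
      exact (((h _ continuous_fst).add (h _ continuous_snd)).div_const 2).const_mul ε
    · exact ((continuous_fst.sub continuous_snd).div_const 2).abs.rpow_const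
        fun _ => Or.inr hp0.le
  have hpos : ∀ x ∈ S, 0 < G x := by
    rintro ⟨a, b⟩ ⟨h1, h2⟩
    refine sub_pos.2 (abs_midpoint_rpow_lt hp ?_)
    rintro h
    simp only at h
    subst h
    simp only [Set.mem_ofPred_eq, sub_self, zero_div, abs_zero, Real.zero_rpow hp0.ne'] at h2
    have ha : |a| = 1 := by simpa [Prod.norm_def] using h1
    rw [ha] at h2
    norm_num at h2
    linarith
  obtain ⟨δ, hδ, hδG⟩ : ∃ δ > 0, ∀ x ∈ S, δ ≤ G x := by
    rcases S.eq_empty_or_nonempty with h | h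
    · exact ⟨1, one_pos, by simp [h]⟩
    · obtain ⟨x, hx, hmin⟩ := hS.exists_isMinOn h hG.continuousOn
      exact ⟨G x, hpos x hx, fun y hy => hmin hy⟩
  refine ⟨1 / δ, by positivity, fun a b => ?_⟩
  have hnn : ∀ a b : ℝ, 0 ≤ (|a| ^ p + |b| ^ p) / 2 - |(a + b) / 2| ^ p := fun a b =>
    sub_nonneg.2 (abs_midpoint_rpow_le hp a b)
  have key : ∀ a b : ℝ, ‖((a, b) : ℝ × ℝ)‖ = 1 → |(a - b) / 2| ^ p ≤
      ε * ((|a| ^ p + |b| ^ p) / 2) +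
        1 / δ * ((|a| ^ p + |b| ^ p) / 2 - |(a + b) / 2| ^ p) := by
    intro a b hab
    by_cases h : ε * ((|a| ^ p + |b| ^ p) / 2) ≤ |(a - b) / 2| ^ p
    · have h1 := hδG (a, b) ⟨by simpa using hab, h⟩
      have h2 : 1 ≤ 1 / δ * ((|a| ^ p + |b| ^ p) / 2 - |(a + b) / 2| ^ p) := by
        rw [one_div, ← div_eq_inv_mul, one_le_div hδ]; exact h1
      have h3 : |(a - b) / 2| ^ p ≤ 1 := by
        refine Real.rpow_le_one (abs_nonneg _) ?_ hp0.le
        have ha : |a| ≤ 1 := hab ▸ norm_fst_le (a, b)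
        have hb : |b| ≤ 1 := hab ▸ norm_snd_le (a, b)
        rw [abs_div, abs_two]
        linarith [abs_sub a b]
      have : 0 ≤ ε * ((|a| ^ p + |b| ^ p) / 2) := by positivity
      linarith
    · have := mul_nonneg (one_div_pos.2 hδ).le (hnn a b)
      linarith
  rcases eq_or_ne ((a, b) : ℝ × ℝ) 0 with h | h
  · obtain ⟨rfl, rfl⟩ := Prod.mk_eq_zero.1 h
    simp [Real.zero_rpow hp0.ne']
  -- All terms are homogeneous of degree `p`, so the unit sphere suffices.
  set r := ‖((a, b) : ℝ × ℝ)‖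
  have hr : 0 < r := norm_pos_iff.2 h
  have h1 := key (a / r) (b / r) (by
    have : ((a / r, b / r) : ℝ × ℝ) = r⁻¹ • (a, b) := by
      simp [Prod.smul_mk, div_eq_inv_mul]
    rw [this, norm_smul, norm_inv, Real.norm_of_nonneg hr.le]
    exact inv_mul_cancel₀ hr.ne')
  have h2 : ∀ x : ℝ, |x / r| ^ p = |x| ^ p / r ^ p := fun x => by
    rw [abs_div, abs_of_pos hr, Real.div_rpow (abs_nonneg _) hr.le]
  rw [show (a / r - b / r) / 2 = (a - b) / 2 / r by ring,
    show (a / r + b / r) / 2 = (a + b) / 2 / r by ring, h2, h2, h2, h2] at h1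
  have hrp : 0 < r ^ p := Real.rpow_pos_of_pos hr _
  have h3 := mul_le_mul_of_nonneg_right h1 hrp.le
  rw [div_mul_cancel₀ _ hrp.ne'] at h3
  refine h3.trans_eq ?_
  field_simp

/-- A normed space whose norm satisfies the quantitative convexity inequality of
`exists_abs_half_sub_rpow_le` is uniformly convex. -/
lemma uniformConvexSpace_of_rpow {E : Type*} [NormedAddCommGroup E] {p : ℝ} (hp : 1 < p)
    (h : ∀ ε : ℝ, 0 < ε → ∃ C : ℝ, 0 < C ∧ ∀ u v : E, (‖u - v‖ / 2) ^ p ≤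
      ε * ((‖u‖ ^ p + ‖v‖ ^ p) / 2) + C * ((‖u‖ ^ p + ‖v‖ ^ p) / 2 - (‖u + v‖ / 2) ^ p)) :
    UniformConvexSpace E := by
  refine ⟨fun η hη => ?_⟩
  have hη' : 0 < (η / 2) ^ p := Real.rpow_pos_of_pos (by positivity) _
  -- For unit vectors at distance at least `η`, this choice lets the `ε`-term absorb only half of
  -- the left side.
  obtain ⟨C, hC, hCuv⟩ := h ((η / 2) ^ p / 2) (by positivity)
  refine ⟨(η / 2) ^ p / (p * C), by positivity, fun u hu v hv huv => ?_⟩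
  have h1 := hCuv u v
  rw [hu, hv, Real.one_rpow] at h1
  have h2 : (η / 2) ^ p ≤ (‖u - v‖ / 2) ^ p :=
    Real.rpow_le_rpow (by positivity) (by linarith) (by linarith)
  set t := ‖u + v‖ / 2 with ht
  -- Bernoulli's inequality replaces the defect `1 - t ^ p` by `p * (1 - t)`, which is linear in the
  -- norm of the sum.
  have h3 : 1 + p * (t - 1) ≤ t ^ p := by
    have := one_add_mul_self_le_rpow_one_add (s := t - 1)
      (by have : 0 ≤ t := by positivity
          linarith) hp.le
    simpa using this
  have h4 : (η / 2) ^ p ≤ (η / 2) ^ p / 2 + C * (p * (1 - t)) := by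
    have : C * (1 - t ^ p) ≤ C * (p * (1 - t)) := by gcongr; linarith
    norm_num at h1
    linarith
  have h5 : (η / 2) ^ p / (p * C) ≤ 2 * (1 - t) := by
    rw [div_le_iff₀ (by positivity)]
    nlinarith
  linarith

/-! ### Reflexivity of uniformly convex Banach spaces -/

/-- A special case of Helly's theorem: any two functionals are approximately evaluated on an
element of the bidual by an element of the space with the same bound of the norm. -/
lemma exists_approx_bidual {E : Type*} [NormedAddCommGroup E] [NormedSpace ℝ E]
    (Φ : StrongDual ℝ (StrongDual ℝ E)) (hΦ : ‖Φ‖ ≤ 1) (f g : StrongDual ℝ E) {ε : ℝ}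
    (hε : 0 < ε) : ∃ x : E, ‖x‖ ≤ 1 ∧ |f x - Φ f| < ε ∧ |g x - Φ g| < ε := by
  set T : E →L[ℝ] ℝ × ℝ := f.prod g
  -- Otherwise a functional on the plane separates the point from the convex image of the ball.
  -- Pulled back to `E` it is a combination `k` of `f` and `g` with `‖k‖ ≤ r < Φ k`, against `‖Φ‖ ≤
  -- 1`.
  have hmem : (Φ f, Φ g) ∈ closure (T '' Metric.closedBall 0 1) := by
    by_contra hnot
    obtain ⟨m, r, h1, h2⟩ := geometric_hahn_banach_closed_point
      (((convex_closedBall (0 : E) 1).linear_image (T : E →ₗ[ℝ] ℝ × ℝ)).closure)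
      isClosed_closure hnot
    set k : StrongDual ℝ E := m (1, 0) • f + m (0, 1) • g
    have hm : ∀ a b : ℝ, m (a, b) = m (1, 0) * a + m (0, 1) * b := fun a b => by
      have : ((a, b) : ℝ × ℝ) = a • (1, 0) + b • (0, 1) := by simp
      rw [this, map_add, map_smul, map_smul, smul_eq_mul, smul_eq_mul]
      ring
    have hk : ∀ x : E, ‖x‖ ≤ 1 → k x < r := fun x hx => by
      have := h1 (T x) (subset_closure ⟨x, by simpa using hx, rfl⟩)
      rwa [show T x = (f x, g x) from rfl, hm] at this
    have hr : 0 < r := by simpa using hk 0 (by simp)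
    have hkn : ‖k‖ ≤ r := by
      refine ContinuousLinearMap.opNorm_le_of_unit_norm hr.le fun x hx => ?_
      rw [Real.norm_eq_abs, abs_le]
      have h3 := hk x hx.le
      have h4 := hk (-x) (by simp [hx])
      rw [map_neg] at h4
      exact ⟨by linarith, h3.le⟩
    have hΦk : Φ k ≤ ‖k‖ := by
      refine (le_abs_self _).trans ((Φ.le_opNorm k).trans ?_)
      exact mul_le_of_le_one_left (norm_nonneg _) hΦ
    have : Φ k = m (Φ f, Φ g) := by
      rw [hm]
      simp [k]
    linarith
  obtain ⟨_, ⟨x, hx, rfl⟩, hd⟩ := Metric.mem_closure_iff.1 hmem ε hε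
  rw [dist_comm, Prod.dist_eq, max_lt_iff] at hd
  exact ⟨x, by simpa using hx, hd.1, hd.2⟩

/-- In a uniformly convex space, a functional on the dual of norm `1` is uniformly close to an
evaluation. -/
lemma exists_abs_sub_le_of_uniformConvex {E : Type*} [NormedAddCommGroup E] [NormedSpace ℝ E]
    [UniformConvexSpace E] (Φ : StrongDual ℝ (StrongDual ℝ E)) (hΦ : ‖Φ‖ ≤ 1)
    (hΦ' : ∀ t < (1 : ℝ), ∃ f : StrongDual ℝ E, ‖f‖ ≤ 1 ∧ t < Φ f) {ε : ℝ} (hε : 0 < ε) :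
    ∃ x : E, ∀ g : StrongDual ℝ E, |Φ g - g x| ≤ ε * ‖g‖ := by
  obtain ⟨δ, hδ, hconv⟩ := exists_forall_closed_ball_dist_add_le_two_sub E hε
  obtain ⟨f, hf1, hf⟩ := hΦ' (1 - δ / 4) (by linarith)
  -- The slice of the unit ball cut off by an almost norming `f` has diameter at most `ε`.
  have hclose : ∀ x y : E, ‖x‖ ≤ 1 → ‖y‖ ≤ 1 → 1 - δ / 2 < f x → 1 - δ / 2 < f y →
      ‖x - y‖ ≤ ε := by
    intro x y hx hy hfx hfy
    by_contra hcon
    have h1 := hconv hx hy (not_le.1 hcon).le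
    have h2 : f (x + y) ≤ ‖x + y‖ :=
      (le_abs_self _).trans ((f.le_opNorm _).trans (mul_le_of_le_one_left (norm_nonneg _) hf1))
    rw [map_add] at h2
    linarith
  obtain ⟨x, hx1, hx2, -⟩ := exists_approx_bidual Φ hΦ f f (ε := δ / 4) (by positivity)
  rw [abs_lt] at hx2
  refine ⟨x, fun g => le_of_forall_pos_le_add fun η hη => ?_⟩
  -- `y` depends on `g`, but it lies in the same slice as the fixed point `x`; this makes the
  -- estimate uniform in `g`.
  obtain ⟨y, hy1, hy2, hy3⟩ := exists_approx_bidual Φ hΦ f g (ε := min (δ / 4) η)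
    (by positivity)
  rw [lt_min_iff, abs_lt] at hy2
  have h1 := hclose x y hx1 hy1 (by linarith [hx2.1]) (by linarith [hy2.1.1])
  have h2 : |g (y - x)| ≤ ε * ‖g‖ := by
    refine (g.le_opNorm _).trans ?_
    rw [mul_comm, norm_sub_rev]
    gcongr
  have h3 : |g y - Φ g| < η := lt_of_lt_of_le hy3 (min_le_right _ _)
  have h4 : Φ g - g x = -(g y - Φ g) + g (y - x) := by
    rw [map_sub]
    ring
  rw [h4]
  refine (abs_add_le _ _).trans ?_
  rw [abs_neg]
  linarith

/-- The **Milman–Pettis theorem**. -/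
theorem UniformConvexSpace.surjective_inclusionInDoubleDual (E : Type*) [NormedAddCommGroup E]
    [NormedSpace ℝ E] [CompleteSpace E] [UniformConvexSpace E] :
    Function.Surjective (NormedSpace.inclusionInDoubleDual ℝ E) := by
  intro Φ
  suffices h : ∃ x : E, ∀ g, Φ g = g x by
    obtain ⟨x, hx⟩ := h
    exact ⟨x, ContinuousLinearMap.ext fun g => (hx g).symm⟩
  rcases (norm_nonneg Φ).eq_or_lt with h0 | h0
  · refine ⟨0, fun g => ?_⟩
    have := Φ.le_opNorm g
    rw [← h0, zero_mul] at this
    rw [norm_le_zero_iff.1 this, map_zero]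
  have happrox : ∀ n : ℕ, ∃ x : E, ∀ g : StrongDual ℝ E,
      |(‖Φ‖⁻¹ • Φ) g - g x| ≤ (1 / 2) ^ n * ‖g‖ := by
    refine fun n => exists_abs_sub_le_of_uniformConvex (‖Φ‖⁻¹ • Φ) ?_ ?_ (by positivity)
    · refine (ContinuousLinearMap.opNorm_smul_le _ _).trans_eq ?_
      rw [norm_inv, Real.norm_of_nonneg h0.le, inv_mul_cancel₀ h0.ne']
    · intro t ht
      obtain ⟨f, hf1, hf⟩ := Φ.exists_lt_apply_of_lt_opNorm
        (show t * ‖Φ‖ < ‖Φ‖ from mul_lt_of_lt_one_left h0 ht)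
      rw [← lt_div_iff₀ h0, div_eq_inv_mul] at hf
      rcases le_total 0 (Φ f) with h | h
      · exact ⟨f, hf1.le, by rwa [Real.norm_of_nonneg h] at hf⟩
      · exact ⟨-f, by simpa using hf1.le, by rwa [Real.norm_of_nonpos h, ← map_neg] at hf⟩
  choose x hx using happrox
  -- The norm of `x n - x (n + 1)` is tested on functionals, where both points approximate the same
  -- normalised `Φ`.
  have hcauchy : CauchySeq x := by
    refine cauchySeq_of_le_geometric (1 / 2) 2 (by norm_num) fun n => ?_
    rw [dist_eq_norm]
    refine NormedSpace.norm_le_dual_bound ℝ _ (by positivity) fun g => ?_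
    have h1 := hx n g
    have h2 := hx (n + 1) g
    rw [pow_succ] at h2
    rw [map_sub, Real.norm_eq_abs, show g (x n) - g (x (n + 1))
      = ((‖Φ‖⁻¹ • Φ) g - g (x (n + 1))) - ((‖Φ‖⁻¹ • Φ) g - g (x n)) by ring]
    refine (abs_sub _ _).trans ?_
    have : 0 ≤ (1 / 2 : ℝ) ^ n * ‖g‖ := by positivity
    linarith
  obtain ⟨z, hz⟩ := cauchySeq_tendsto_of_complete hcauchy
  refine ⟨‖Φ‖ • z, fun g => ?_⟩
  have h1 : Tendsto (fun n => |(‖Φ‖⁻¹ • Φ) g - g (x n)|) atTop (𝓝 0) := by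
    refine squeeze_zero (fun _ => abs_nonneg _) (fun n => hx n g) ?_
    simpa using (tendsto_pow_atTop_nhds_zero_of_lt_one (by norm_num : (0 : ℝ) ≤ 1 / 2)
      (by norm_num)).mul_const ‖g‖
  have h2 := tendsto_nhds_unique h1
    (tendsto_const_nhds.sub ((g.continuous.tendsto z).comp hz)).abs
  have h3 : ‖Φ‖⁻¹ * Φ g = g z := sub_eq_zero.1 (abs_eq_zero.1 h2.symm)
  rw [map_smul, smul_eq_mul, ← h3, mul_inv_cancel_left₀ h0.ne']

namespace VicsekScale

/-! ### Lattice coordinates -/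

/-- After division by `corner 0` the corners are the powers of `I`, so rescaled vertices become
Gaussian integers. -/
lemma corner_eq (j : Fin 4) : corner j = Complex.I ^ (j : ℕ) * corner 0 := by
  have h : (2 * ((j : ℕ) : ℂ) + 1) * (Real.pi : ℂ) * Complex.I / 4
      = ((j : ℕ) : ℂ) * (Real.pi / 2 * Complex.I)
        + (2 * (((0 : Fin 4) : ℕ) : ℂ) + 1) * (Real.pi : ℂ) * Complex.I / 4 := by
    simp; ring
  rw [corner, h, Complex.exp_add, Complex.exp_nat_mul, Complex.exp_pi_div_two_mul_I, corner]

lemma corner_ne_zero (j : Fin 4) : corner j ≠ 0 := by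
  rw [← norm_ne_zero_iff, norm_corner]; exact one_ne_zero

lemma corner_add_two (j : Fin 4) : corner (j + 2) = - corner j := by
  rw [corner_eq (j + 2), corner_eq j]
  fin_cases j <;> simp [pow_succ]

lemma mem_digits {m : ℕ} {s : ℂ} : s ∈ digits m ↔
    ∃ a ≤ (m - 1) / 2, ∃ j : Fin 4, s = 2 * (a : ℂ) / (m : ℂ) * corner j := by
  simp only [digits, Finset.mem_image, Finset.mem_product, Finset.mem_range, Finset.mem_univ,
    and_true, Prod.exists, Nat.lt_succ_iff]
  constructor
  · rintro ⟨a, j, h, rfl⟩; exact ⟨a, h, j, rfl⟩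
  · rintro ⟨a, h, j, rfl⟩; exact ⟨a, j, h, rfl⟩

variable (l : VicsekScale)

lemma scale_pos (n : ℕ) : 0 < l.scale n := Finset.prod_pos fun k _ => l.ratio_pos k

lemma scale_succ (n : ℕ) : l.scale (n + 1) = l.scale n * l.ratio n :=
  Finset.prod_range_succ _ _

lemma scale_cast_ne_zero (n : ℕ) : (l.scale n : ℂ) ≠ 0 := by
  exact_mod_cast (l.scale_pos n).ne'

lemma ratio_cast_ne_zero (n : ℕ) : (l.ratio n : ℂ) ≠ 0 := by
  exact_mod_cast (l.ratio_pos n).ne'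

lemma wordMap_eq (n : ℕ) (w : Word l n) (z : ℂ) :
    wordMap l n w z = wordMap l n w 0 + z / (l.scale n : ℂ) := by
  have := wordMap_sub l n w z 0
  rw [sub_zero] at this
  rw [← this]; ring

lemma wordMap_succ_zero (n : ℕ) (w : Word l (n + 1)) :
    wordMap l (n + 1) w 0 =
      wordMap l n (fun k => w k.castSucc) 0 + (w (Fin.last n) : ℂ) / (l.scale n : ℂ) := by
  rw [wordMap, contraction, zero_div, add_zero, wordMap_eq]

/-- The digits are the even points `2 (a + b i)` of a cross, up to similarity. -/
lemma exists_int_of_mem_digits {m : ℕ} (hm : Odd m) {s : ℂ} (hs : s ∈ digits m) :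
    ∃ a b : ℤ, (a = 0 ∨ b = 0) ∧ 2 * |a| + 1 ≤ m ∧ 2 * |b| + 1 ≤ m ∧
      s * (m : ℂ) = 2 * ((a : ℂ) + (b : ℂ) * Complex.I) * corner 0 := by
  obtain ⟨a, ha, j, rfl⟩ := mem_digits.1 hs
  obtain ⟨k, hk⟩ := hm
  have hm0 : (m : ℂ) ≠ 0 := by
    have : m ≠ 0 := by omega
    exact_mod_cast this
  have h1 : (2 * (a : ℤ) + 1 : ℤ) ≤ m := by omega
  have h2 : |(a : ℤ)| = a := abs_of_nonneg (by positivity)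
  have h3 : (1 : ℤ) ≤ m := by omega
  rw [corner_eq j, show 2 * (a : ℂ) / (m : ℂ) * (Complex.I ^ (j : ℕ) * corner 0) * (m : ℂ)
    = 2 * ((a : ℂ) * Complex.I ^ (j : ℕ)) * corner 0 by field_simp]
  fin_cases j
  · exact ⟨a, 0, by simp, by rwa [h2], by simpa using h3, by simp⟩
  · exact ⟨0, a, by simp, by simpa using h3, by rwa [h2], by simp⟩
  · exact ⟨-a, 0, by simp, by rwa [abs_neg, h2], by simpa using h3, by simp⟩
  · exact ⟨0, -a, by simp, by simpa using h3, by rwa [abs_neg, h2],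
      by simp [pow_succ]⟩

lemma int_eq_of_mul_corner_eq {a b c d : ℤ}
    (h : ((a : ℂ) + (b : ℂ) * Complex.I) * corner 0 = ((c : ℂ) + (d : ℂ) * Complex.I) * corner 0) :
    a = c ∧ b = d := by
  have h := mul_right_cancel₀ (corner_ne_zero 0) h
  have h1 := congrArg Complex.re h
  have h2 := congrArg Complex.im h
  simp at h1 h2
  exact ⟨h1, h2⟩

/-- The centres of the cells are even lattice points, up to similarity. -/
lemma exists_int_center (n : ℕ) (w : Word l n) : ∃ a b : ℤ,
    wordMap l n w 0 * (l.scale n : ℂ) = 2 * ((a : ℂ) + (b : ℂ) * Complex.I) * corner 0 := by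
  induction n with
  | zero => exact ⟨0, 0, by simp [wordMap]⟩
  | succ n ih =>
    obtain ⟨a, b, hab⟩ := ih fun k => w k.castSucc
    obtain ⟨c, d, -, -, -, hcd⟩ := exists_int_of_mem_digits (l.odd_ratio n) (w (Fin.last n)).2
    refine ⟨l.ratio n * a + c, l.ratio n * b + d, ?_⟩
    have h0 := l.scale_cast_ne_zero n
    rw [wordMap_succ_zero, scale_succ]
    push_cast
    calc _ = wordMap l n (fun k => w k.castSucc) 0 * (l.scale n : ℂ) * l.ratio n
          + (w (Fin.last n) : ℂ) * l.ratio n := by field_simp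
      _ = _ := by rw [hab, hcd]; ring

/-- Two balanced remainders differ by less than `m`. -/
lemma int_eq_of_balanced {m : ℕ} {a c a' c' : ℤ} (hc : 2 * |c| + 1 ≤ m) (hc' : 2 * |c'| + 1 ≤ m)
    (h : m * a + c = m * a' + c') : a = a' ∧ c = c' := by
  have h1 := abs_le.1 (show |c| ≤ |c| from le_rfl)
  have h2 := abs_le.1 (show |c'| ≤ |c'| from le_rfl)
  have h3 : a = a' := by
    rcases lt_trichotomy a a' with h4 | h4 | h4
    · nlinarith
    · exact h4
    · nlinarith
  subst h3
  exact ⟨rfl, by linarith⟩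

/-- Half of the rescaled centre is an expansion in the mixed radices `l.ratio k` with balanced
digits in each coordinate: the last letter is the remainder and the prefix the quotient. -/
lemma wordMap_zero_injective (n : ℕ) :
    Function.Injective fun w : Word l n => wordMap l n w 0 := by
  induction n with
  | zero => intro w w' _; exact Subsingleton.elim _ _
  | succ n ih =>
    intro w w' h
    simp only [wordMap_succ_zero] at h
    obtain ⟨a, b, hab⟩ := l.exists_int_center n fun k => w k.castSucc
    obtain ⟨a', b', hab'⟩ := l.exists_int_center n fun k => w' k.castSucc
    obtain ⟨c, d, -, hc, hd, hcd⟩ :=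
      exists_int_of_mem_digits (l.odd_ratio n) (w (Fin.last n)).2
    obtain ⟨c', d', -, hc', hd', hcd'⟩ :=
      exists_int_of_mem_digits (l.odd_ratio n) (w' (Fin.last n)).2
    have h0 := l.scale_cast_ne_zero n
    have h1 := l.ratio_cast_ne_zero n
    have h2 := congrArg (fun z => z * (l.scale n : ℂ) * (l.ratio n : ℂ) / 2) h
    simp only [add_mul, div_mul_cancel₀ _ h0] at h2
    rw [hab, hab', hcd, hcd'] at h2
    have h3 : (((l.ratio n * a + c : ℤ) : ℂ) + ((l.ratio n * b + d : ℤ) : ℂ) * Complex.I)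
          * corner 0
        = (((l.ratio n * a' + c' : ℤ) : ℂ) + ((l.ratio n * b' + d' : ℤ) : ℂ) * Complex.I)
          * corner 0 := by
      push_cast
      linear_combination h2
    obtain ⟨h4, h5⟩ := int_eq_of_mul_corner_eq h3
    obtain ⟨rfl, rfl⟩ := int_eq_of_balanced hc hc' h4
    obtain ⟨rfl, rfl⟩ := int_eq_of_balanced hd hd' h5
    have h6 := ih (mul_right_cancel₀ h0 (hab.trans hab'.symm))
    have h7 : w (Fin.last n) = w' (Fin.last n) :=
      Subtype.ext (mul_right_cancel₀ h1 (hcd.trans hcd'.symm))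
    funext k
    refine Fin.lastCases h7 (fun i => ?_) k
    exact congrFun h6 i

/-! ### The edges -/

lemma mem_planeVertices {n : ℕ} {z : ℂ} : z ∈ planeVertices l n ↔
    ∃ w : Word l n, z = wordMap l n w 0 ∨ ∃ j, z = wordMap l n w (corner j) := by
  simp only [planeVertices, baseVertices, Finset.mem_image, Finset.mem_product, Finset.mem_univ,
    true_and, Finset.mem_insert, Prod.exists]
  constructor
  · rintro ⟨w, q, rfl | ⟨j, rfl⟩, rfl⟩
    · exact ⟨w, Or.inl rfl⟩
    · exact ⟨w, Or.inr ⟨j, rfl⟩⟩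
  · rintro ⟨w, rfl | ⟨j, rfl⟩⟩
    · exact ⟨w, 0, Or.inl rfl, rfl⟩
    · exact ⟨w, corner j, Or.inr ⟨j, rfl⟩, rfl⟩

lemma wordMap_zero_mem (n : ℕ) (w : Word l n) : wordMap l n w 0 ∈ carrier l :=
  planeVertices_subset l n _ (l.mem_planeVertices.2 ⟨w, Or.inl rfl⟩)

lemma wordMap_corner_mem (n : ℕ) (w : Word l n) (j : Fin 4) :
    wordMap l n w (corner j) ∈ carrier l :=
  planeVertices_subset l n _ (l.mem_planeVertices.2 ⟨w, Or.inr ⟨j, rfl⟩⟩)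

lemma mem_edges {n : ℕ} {x y : carrier l} : (x, y) ∈ edges l n ↔
    (x : ℂ) ∈ planeVertices l n ∧ (y : ℂ) ∈ planeVertices l n ∧
      dist (x : ℂ) y = (l.scale n : ℝ)⁻¹ := by
  simp [edges, vertices, Subtype.dist_eq, and_assoc]

/-- The parity of `a + b` is recorded because it distinguishes centres from corners. -/
lemma int_cases_of_norm_eq_one {a b : ℤ} (h : ‖((a : ℂ) + (b : ℂ) * Complex.I)‖ = 1) :
    ∃ j : Fin 4, ((a : ℂ) + (b : ℂ) * Complex.I) = Complex.I ^ (j : ℕ) ∧ Odd (a + b) := by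
  have h1 : a ^ 2 + b ^ 2 = 1 := by
    have := congrArg (· ^ 2) h
    simp only [← Complex.normSq_eq_norm_sq, Complex.normSq_apply] at this
    simp at this
    rify
    linarith
  have ha : -1 ≤ a ∧ a ≤ 1 := ⟨by nlinarith, by nlinarith⟩
  have hb : -1 ≤ b ∧ b ≤ 1 := ⟨by nlinarith, by nlinarith⟩
  obtain ⟨ha1, ha2⟩ := ha
  obtain ⟨hb1, hb2⟩ := hb
  interval_cases a <;> interval_cases b <;> simp at h1
  · exact ⟨2, by simp, by decide⟩
  · exact ⟨3, by simp [pow_succ], by decide⟩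
  · exact ⟨1, by simp, by decide⟩
  · exact ⟨0, by simp, by decide⟩

/-- A checkerboard colouring: both coordinates of a centre are even, and a corner differs from a
centre by a unit. -/
lemma exists_int_vertex {n : ℕ} {z : ℂ} (hz : z ∈ planeVertices l n) : ∃ a b : ℤ,
    z * (l.scale n : ℂ) = ((a : ℂ) + (b : ℂ) * Complex.I) * corner 0 ∧
      ((∃ w, z = wordMap l n w 0) ∧ Even (a + b) ∨
        (∃ w j, z = wordMap l n w (corner j)) ∧ Odd (a + b)) := by
  have h0 := l.scale_cast_ne_zero n
  obtain ⟨w, rfl | ⟨j, rfl⟩⟩ := l.mem_planeVertices.1 hz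
  · obtain ⟨a, b, h⟩ := l.exists_int_center n w
    refine ⟨2 * a, 2 * b, ?_, Or.inl ⟨⟨w, rfl⟩, a + b, by ring⟩⟩
    rw [h]; push_cast; ring
  · obtain ⟨a, b, h⟩ := l.exists_int_center n w
    rw [wordMap_eq, add_mul, h, div_mul_cancel₀ _ h0, corner_eq j]
    have key : ∃ c d : ℤ, Complex.I ^ (j : ℕ) = (c : ℂ) + (d : ℂ) * Complex.I ∧ Odd (c + d) := by
      fin_cases j
      · exact ⟨1, 0, by simp, by decide⟩
      · exact ⟨0, 1, by simp, by decide⟩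
      · exact ⟨-1, 0, by simp, by decide⟩
      · exact ⟨0, -1, by simp [pow_succ], by decide⟩
    obtain ⟨c, d, hcd, hodd⟩ := key
    refine ⟨2 * a + c, 2 * b + d, ?_, Or.inr ⟨⟨w, j, by rw [wordMap_eq l n w (corner j), corner_eq j]⟩, ?_⟩⟩
    · rw [hcd]; push_cast; ring
    · obtain ⟨k, hk⟩ := hodd
      exact ⟨a + b + k, by linarith⟩

lemma wordMap_zero_ne_wordMap_corner (n : ℕ) (w w' : Word l n) (j : Fin 4) :
    wordMap l n w 0 ≠ wordMap l n w' (corner j) := by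
  intro h
  obtain ⟨a, b, hab⟩ := l.exists_int_center n w
  obtain ⟨a', b', hab'⟩ := l.exists_int_center n w'
  have h0 := l.scale_cast_ne_zero n
  have h1 := congrArg (fun z => z * (l.scale n : ℂ)) h
  rw [wordMap_eq l n w' (corner j), add_mul, div_mul_cancel₀ _ h0, hab, hab'] at h1
  have h2 : ((((2 * (a - a') : ℤ) : ℂ) + ((2 * (b - b') : ℤ) : ℂ) * Complex.I) * corner 0)
      = corner j := by
    push_cast
    linear_combination h1
  have h3 := congrArg norm h2
  rw [norm_mul, norm_corner, norm_corner, mul_one] at h3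
  obtain ⟨-, -, k, hk⟩ := int_cases_of_norm_eq_one h3
  omega

lemma corner_injective : Function.Injective corner := by
  intro i j h
  rw [corner_eq i, corner_eq j] at h
  have h := mul_right_cancel₀ (corner_ne_zero 0) h
  have h1 := congrArg Complex.re h
  have h2 := congrArg Complex.im h
  fin_cases i <;> fin_cases j <;>
    first
    | rfl
    | (exfalso; norm_num [pow_succ] at h1; done)
    | (exfalso; norm_num [pow_succ] at h2)

/-- Vertices at unit lattice distance have opposite parity, so exactly one of them is a centre. The
other is this centre plus a power of `I`, hence a corner of the same cell, whichever cell it was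
first taken from. -/
lemma exists_corner_of_dist_eq {n : ℕ} {x y : ℂ} (hx : x ∈ planeVertices l n)
    (hy : y ∈ planeVertices l n) (hd : dist x y = (l.scale n : ℝ)⁻¹) :
    ∃ (w : Word l n) (j : Fin 4), (x = wordMap l n w 0 ∧ y = wordMap l n w (corner j)) ∨
      (x = wordMap l n w (corner j) ∧ y = wordMap l n w 0) := by
  have h0 := l.scale_cast_ne_zero n
  have aux : ∀ {x y : ℂ}, x ∈ planeVertices l n → y ∈ planeVertices l n →
      dist x y = (l.scale n : ℝ)⁻¹ → (∃ w, x = wordMap l n w 0) →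
      ∃ (w : Word l n) (j : Fin 4), x = wordMap l n w 0 ∧ y = wordMap l n w (corner j) := by
    rintro x y hx hy hd ⟨w, rfl⟩
    obtain ⟨a, b, hab, -⟩ := l.exists_int_vertex hx
    obtain ⟨c, d, hcd, -⟩ := l.exists_int_vertex hy
    have h2 : (y - wordMap l n w 0) * (l.scale n : ℂ)
        = (((c - a : ℤ) : ℂ) + ((d - b : ℤ) : ℂ) * Complex.I) * corner 0 := by
      rw [sub_mul, hab, hcd]; push_cast; ring
    have h3 := congrArg norm h2
    rw [norm_mul, norm_mul, norm_corner, mul_one, ← dist_eq_norm, dist_comm, hd,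
      Complex.norm_natCast, inv_mul_cancel₀ (by exact_mod_cast (l.scale_pos n).ne')] at h3
    obtain ⟨j, hj, -⟩ := int_cases_of_norm_eq_one h3.symm
    refine ⟨w, j, rfl, ?_⟩
    rw [hj, ← corner_eq] at h2
    rw [wordMap_eq, ← h2, mul_div_cancel_right₀ _ h0]
    ring
  obtain ⟨a, b, hab, hab'⟩ := l.exists_int_vertex hx
  obtain ⟨c, d, hcd, hcd'⟩ := l.exists_int_vertex hy
  have h2 : (x - y) * (l.scale n : ℂ)
      = (((a - c : ℤ) : ℂ) + ((b - d : ℤ) : ℂ) * Complex.I) * corner 0 := by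
    rw [sub_mul, hab, hcd]; push_cast; ring
  have h3 := congrArg norm h2
  rw [norm_mul, norm_mul, norm_corner, mul_one, ← dist_eq_norm, hd,
    Complex.norm_natCast, inv_mul_cancel₀ (by exact_mod_cast (l.scale_pos n).ne')] at h3
  obtain ⟨-, -, k, hk⟩ := int_cases_of_norm_eq_one h3.symm
  rcases hab' with ⟨h, -⟩ | ⟨-, h⟩
  · obtain ⟨w, j, h1, h2⟩ := aux hx hy hd h
    exact ⟨w, j, Or.inl ⟨h1, h2⟩⟩
  · rcases hcd' with ⟨h', -⟩ | ⟨-, h'⟩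
    · obtain ⟨w, j, h1, h2⟩ := aux hy hx (by rwa [dist_comm]) h'
      exact ⟨w, j, Or.inr ⟨h2, h1⟩⟩
    · exfalso
      obtain ⟨i, hi⟩ := h
      obtain ⟨i', hi'⟩ := h'
      omega

lemma dist_wordMap_corner (n : ℕ) (w : Word l n) (j : Fin 4) :
    dist (wordMap l n w 0) (wordMap l n w (corner j)) = (l.scale n : ℝ)⁻¹ := by
  rw [dist_eq_norm, wordMap_sub, zero_sub, norm_div, norm_neg, norm_corner, Complex.norm_natCast,
    one_div]

/-- Every edge joins the centre of a cell to one of its corners, in one of two directions. -/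
lemma sum_edges (n : ℕ) (f : carrier l × carrier l → ℝ) (hf : ∀ x y, f (x, y) = f (y, x)) :
    ∑ e ∈ edges l n, f e = 2 * ∑ w : Word l n, ∑ j : Fin 4,
      f (⟨_, l.wordMap_zero_mem n w⟩, ⟨_, l.wordMap_corner_mem n w j⟩) := by
  set c : Word l n → carrier l := fun w => ⟨_, l.wordMap_zero_mem n w⟩
  set v : Word l n → Fin 4 → carrier l := fun w j => ⟨_, l.wordMap_corner_mem n w j⟩
  have hc : Function.Injective c := fun w w' h =>
    l.wordMap_zero_injective n (congrArg Subtype.val h)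
  have hcv : ∀ w w' j, c w ≠ v w' j := fun w w' j h =>
    l.wordMap_zero_ne_wordMap_corner n w w' j (congrArg Subtype.val h)
  have hv : ∀ w, Function.Injective (v w) := fun w i j h => by
    have h1 : wordMap l n w (corner i) = wordMap l n w (corner j) := congrArg Subtype.val h
    rw [wordMap_eq l n w (corner i), wordMap_eq l n w (corner j)] at h1
    exact corner_injective ((div_left_inj' (l.scale_cast_ne_zero n)).1 (add_left_cancel h1))
  -- The Boolean is the direction of the edge, `true` meaning from the centre to the corner.
  have hsum : ∑ i : (Word l n × Fin 4) × Bool,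
      f (if i.2 then (c i.1.1, v i.1.1 i.1.2) else (v i.1.1 i.1.2, c i.1.1)) =
        ∑ e ∈ edges l n, f e := by
    refine Finset.sum_nbij
      (fun i => if i.2 then (c i.1.1, v i.1.1 i.1.2) else (v i.1.1 i.1.2, c i.1.1)) ?_ ?_ ?_ ?_
    · rintro ⟨⟨w, j⟩, _ | _⟩ -
      · exact l.mem_edges.2 ⟨l.mem_planeVertices.2 ⟨w, Or.inr ⟨j, rfl⟩⟩,
          l.mem_planeVertices.2 ⟨w, Or.inl rfl⟩,
          (dist_comm _ _).trans (l.dist_wordMap_corner n w j)⟩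
      · exact l.mem_edges.2 ⟨l.mem_planeVertices.2 ⟨w, Or.inl rfl⟩,
          l.mem_planeVertices.2 ⟨w, Or.inr ⟨j, rfl⟩⟩, l.dist_wordMap_corner n w j⟩
    · rintro ⟨⟨w, j⟩, _ | _⟩ - ⟨⟨w', j'⟩, _ | _⟩ - h
      · simp only [Bool.false_eq_true, if_false, Prod.mk.injEq] at h
        obtain rfl := hc h.2
        obtain rfl := hv w h.1
        rfl
      · simp only [Bool.false_eq_true, if_false, if_true, Prod.mk.injEq] at h
        exact absurd h.1.symm (hcv _ _ _)
      · simp only [Bool.false_eq_true, if_false, if_true, Prod.mk.injEq] at h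
        exact absurd h.1 (hcv _ _ _)
      · simp only [if_true, Prod.mk.injEq] at h
        obtain rfl := hc h.1
        obtain rfl := hv w h.2
        rfl
    · rintro ⟨x, y⟩ he
      obtain ⟨hx, hy, hd⟩ := l.mem_edges.1 he
      obtain ⟨w, j, ⟨h1, h2⟩ | ⟨h1, h2⟩⟩ := l.exists_corner_of_dist_eq hx hy hd
      · exact ⟨((w, j), true), by simp, Prod.ext (Subtype.ext h1.symm) (Subtype.ext h2.symm)⟩
      · exact ⟨((w, j), false), by simp, Prod.ext (Subtype.ext h1.symm) (Subtype.ext h2.symm)⟩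
    · exact fun _ _ => rfl
  rw [← hsum, Fintype.sum_prod_type, Fintype.sum_prod_type]
  simp only [Fintype.sum_bool, if_true, Bool.false_eq_true, if_false, Finset.mul_sum]
  refine Finset.sum_congr rfl fun w _ => Finset.sum_congr rfl fun j _ => ?_
  rw [hf (v w j) (c w)]
  ring

/-! ### Paths in a cell -/

/-- Telescoping and Hölder. The bound keeps the full length `m`, so it serves both for corners (`k =
m`) and for centres of subcells on the way. -/
lemma abs_sub_rpow_le_sum {p : ℝ} (hp : 1 < p) (g : ℕ → ℝ) {k m : ℕ} (hkm : k ≤ m) :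
    |g 0 - g k| ^ p ≤ (m : ℝ) ^ (p - 1) *
      ∑ i ∈ Finset.range m, |g i - g (i + 1)| ^ p := by
  have h1 : |g 0 - g k| ≤ ∑ i ∈ Finset.range k, |g i - g (i + 1)| := by
    rw [← Finset.sum_range_sub' g k]
    exact Finset.abs_sum_le_sum_abs _ _
  have h2 := Real.rpow_sum_le_const_mul_sum_rpow_of_nonneg (s := Finset.range k)
    (f := fun i => |g i - g (i + 1)|) hp.le fun _ _ => abs_nonneg _
  rw [Finset.card_range] at h2
  refine (Real.rpow_le_rpow (abs_nonneg _) h1 (by linarith)).trans (h2.trans ?_)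
  refine mul_le_mul (Real.rpow_le_rpow (by positivity) (by exact_mod_cast hkm) (by linarith))
    (Finset.sum_le_sum_of_subset_of_nonneg (Finset.range_mono hkm) fun _ _ _ => by positivity)
    (by positivity) (by positivity)

/-- The contribution to the discrete energy of the edges from the centre of a cell to its
corners, where `G` is the function in the coordinates of the cell. -/
noncomputable def starEnergy (p : ℝ) (G : ℂ → ℝ) : ℝ := ∑ j : Fin 4, |G 0 - G (corner j)| ^ p

lemma starEnergy_nonneg (p : ℝ) (G : ℂ → ℝ) : 0 ≤ starEnergy p G := by
  unfold starEnergy; positivity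

/-- The norm recovers `a`. The direction is lost only at the central digit, which the four arms
share. -/
lemma digit_mul_corner_injective {m a a' : ℕ} (hm : 0 < m) {j j' : Fin 4}
    (h : 2 * (a : ℂ) / (m : ℂ) * corner j = 2 * (a' : ℂ) / (m : ℂ) * corner j') :
    a = a' ∧ (a ≠ 0 → j = j') := by
  have hm0 : (m : ℂ) ≠ 0 := by exact_mod_cast hm.ne'
  have ha : a = a' := by
    have h1 := congrArg norm h
    simp only [norm_mul, norm_div, norm_corner, Complex.norm_natCast, mul_one] at h1
    have hm1 : (m : ℝ) ≠ 0 := by exact_mod_cast hm.ne'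
    have h2 := (div_left_inj' hm1).1 h1
    have h3 := mul_left_cancel₀ (by simp) h2
    exact_mod_cast h3
  subst ha
  refine ⟨rfl, fun ha0 => corner_injective ?_⟩
  refine mul_left_cancel₀ ?_ h
  have : (a : ℂ) ≠ 0 := by exact_mod_cast ha0
  exact div_ne_zero (mul_ne_zero two_ne_zero this) hm0

/-- The edges of the paths from the centre of a cell to its corners are distinct edges of the
next level. -/
lemma sum_path_le {p : ℝ} {m : ℕ} (hm : Odd m) (G : ℂ → ℝ) :
    ∑ j : Fin 4, ∑ i ∈ Finset.range m,
        |G ((i : ℂ) / m * corner j) - G (((i + 1 : ℕ) : ℂ) / m * corner j)| ^ p ≤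
      ∑ s : digits m, starEnergy p fun z => G (contraction m s z) := by
  obtain ⟨k, hk⟩ := hm
  have hm0 : (m : ℂ) ≠ 0 := by
    have : m ≠ 0 := by omega
    exact_mod_cast this
  -- Even multiples of `corner j / m` are centres, odd ones corners. Step `i` thus belongs to the
  -- cell with centre at index `2 * ((i + 1) / 2)`: for even `i` it leaves this centre towards
  -- corner `j`, for odd `i` it arrives there from the opposite corner `j + 2`.
  have hmem : ∀ j : Fin 4, ∀ i : Fin m,
      2 * ((((i : ℕ) + 1) / 2 : ℕ) : ℂ) / (m : ℂ) * corner j ∈ digits m := fun j i =>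
    mem_digits.2 ⟨_, by have := i.2; omega, j, rfl⟩
  set φ : Fin 4 × Fin m → digits m × Fin 4 := fun x =>
    (⟨_, hmem x.1 x.2⟩, if Even (x.2 : ℕ) then x.1 else x.1 + 2) with hφ
  have hinj : Function.Injective φ := by
    rintro ⟨j, i⟩ ⟨j', i'⟩ h
    simp only [hφ, Prod.mk.injEq, Subtype.mk.injEq] at h
    obtain ⟨h1, h2⟩ := h
    obtain ⟨h3, h4⟩ := digit_mul_corner_injective (by omega) h1
    -- In the central cell only the step `i = 0` occurs, and its corner, not its digit, tells the
    -- arm.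
    by_cases h0 : ((i : ℕ) + 1) / 2 = 0
    · have hi : (i : ℕ) = 0 := by omega
      have hi' : (i' : ℕ) = 0 := by omega
      rw [hi, hi'] at h2
      simp only [Even.zero, if_true] at h2
      exact Prod.ext h2 (Fin.ext (hi.trans hi'.symm))
    · obtain rfl := h4 h0
      have hne : ∀ j : Fin 4, j ≠ j + 2 := by decide
      have hpar : Even (i : ℕ) ↔ Even (i' : ℕ) := by
        by_cases hi : Even (i : ℕ) <;> by_cases hi' : Even (i' : ℕ)
        · simp [hi, hi']
        · simp only [hi, hi', if_true, if_false] at h2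
          exact absurd h2 (hne j)
        · simp only [hi, hi', if_true, if_false] at h2
          exact absurd h2.symm (hne j)
        · simp [hi, hi']
      have : (i : ℕ) = i' := by
        rw [Nat.even_iff, Nat.even_iff] at hpar
        omega
      exact Prod.ext rfl (Fin.ext this)
  set H : digits m × Fin 4 → ℝ := fun x =>
    |G (contraction m x.1 0) - G (contraction m x.1 (corner x.2))| ^ p with hH
  have hedge : ∀ x : Fin 4 × Fin m,
      |G (((x.2 : ℕ) : ℂ) / m * corner x.1) - G ((((x.2 : ℕ) + 1 : ℕ) : ℂ) / m * corner x.1)| ^ p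
        = H (φ x) := by
    rintro ⟨j, i⟩
    simp only [hH, hφ, contraction, zero_div, add_zero]
    rcases Nat.even_or_odd (i : ℕ) with hi | hi
    · have h1 : (i : ℕ) = 2 * (((i : ℕ) + 1) / 2) := by
        rw [Nat.even_iff] at hi; omega
      generalize ((i : ℕ) + 1) / 2 = a at h1
      rw [if_pos hi, h1]
      push_cast
      congr 5
      field_simp
    · have h1 : (i : ℕ) + 1 = 2 * (((i : ℕ) + 1) / 2) := by
        rw [Nat.odd_iff] at hi; omega
      have h2 : ((i : ℕ) : ℂ) = 2 * ((((i : ℕ) + 1) / 2 : ℕ) : ℂ) - 1 := by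
        rw [eq_sub_iff_add_eq]; exact_mod_cast h1
      rw [if_neg (Nat.not_even_iff_odd.2 hi), corner_add_two]
      push_cast
      rw [h2, abs_sub_comm]
      congr 5
      · ring
      · field_simp
        ring
  calc _ = ∑ x : Fin 4 × Fin m, H (φ x) := by
        rw [Fintype.sum_prod_type]
        refine Finset.sum_congr rfl fun j _ => ?_
        rw [Finset.sum_range]
        exact Finset.sum_congr rfl fun i _ => hedge (j, i)
    _ = ∑ y ∈ Finset.univ.image φ, H y :=
        (Finset.sum_image fun _ _ _ _ h => hinj h).symm
    _ ≤ ∑ y, H y := Finset.sum_le_sum_of_subset_of_nonneg (Finset.subset_univ _)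
        fun _ _ _ => by positivity
    _ = _ := by rw [Fintype.sum_prod_type]; rfl

/-- Hölder on paths of `m` edges, one to each corner. The factor `m ^ (p - 1)` is the
renormalisation between consecutive levels, which is why the discrete energies increase. -/
lemma starEnergy_le_sum {p : ℝ} (hp : 1 < p) {m : ℕ} (hm : Odd m) (G : ℂ → ℝ) :
    starEnergy p G ≤
      (m : ℝ) ^ (p - 1) * ∑ s : digits m, starEnergy p fun z => G (contraction m s z) := by
  have hm0 : (m : ℂ) ≠ 0 := by
    have := hm.pos
    exact_mod_cast this.ne'
  refine le_trans ?_ (mul_le_mul_of_nonneg_left (sum_path_le hm G) (by positivity))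
  rw [Finset.mul_sum]
  refine Finset.sum_le_sum fun j _ => ?_
  have := abs_sub_rpow_le_sum hp (fun i : ℕ => G ((i : ℂ) / m * corner j)) (le_refl m)
  simpa [div_self hm0] using this

/-- A digit lies on one of the four paths, `2 * a` steps from the centre. -/
lemma abs_sub_digit_rpow_le_sum {p : ℝ} (hp : 1 < p) {m : ℕ} (hm : Odd m) (G : ℂ → ℝ) {s : ℂ}
    (hs : s ∈ digits m) : |G 0 - G s| ^ p ≤
      (m : ℝ) ^ (p - 1) * ∑ s : digits m, starEnergy p fun z => G (contraction m s z) := by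
  refine le_trans ?_ (mul_le_mul_of_nonneg_left (sum_path_le hm G) (by positivity))
  obtain ⟨a, ha, j, rfl⟩ := mem_digits.1 hs
  have := hm.pos
  have h1 := abs_sub_rpow_le_sum hp (fun i : ℕ => G ((i : ℂ) / m * corner j))
    (show 2 * a ≤ m by omega)
  simp only [Nat.cast_zero, zero_div, zero_mul] at h1
  rw [Nat.cast_mul 2 a, Nat.cast_ofNat] at h1
  refine h1.trans (mul_le_mul_of_nonneg_left ?_ (by positivity))
  exact Finset.single_le_sum (f := fun j => ∑ i ∈ Finset.range m,
        |G ((i : ℂ) / m * corner j) - G (((i + 1 : ℕ) : ℂ) / m * corner j)| ^ p)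
    (fun _ _ => by positivity) (Finset.mem_univ j)

/-! ### Discrete energies in terms of cells -/

variable {l : VicsekScale} {p : ℝ}

open Classical in
/-- The extension by zero of a function on the Vicsek set. -/
noncomputable def zeroExtend (u : C(carrier l, ℝ)) (z : ℂ) : ℝ :=
  if h : z ∈ carrier l then u ⟨z, h⟩ else 0

lemma zeroExtend_of_mem (u : C(carrier l, ℝ)) {z : ℂ} (h : z ∈ carrier l) :
    zeroExtend u z = u ⟨z, h⟩ := dif_pos h

/-- The factor `1 / 2` cancels the double count of directions, leaving one star for each cell. -/
lemma discreteEnergy_eq (n : ℕ) (u : C(carrier l, ℝ)) : discreteEnergy l p n u =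
    (l.scale n : ℝ) ^ (p - 1) *
      ∑ w : Word l n, starEnergy p fun z => zeroExtend u (wordMap l n w z) := by
  have h1 : ∏ k ∈ Finset.range n, (l.ratio k : ℝ) ^ (p - 1) = (l.scale n : ℝ) ^ (p - 1) := by
    rw [Real.finsetProd_rpow _ _ fun _ _ => by positivity, scale]
    push_cast
    rfl
  rw [discreteEnergy, h1, sum_edges l n (fun e => |u e.1 - u e.2| ^ p)
    fun x y => by simp only [abs_sub_comm]]
  rw [show ∀ a b : ℝ, 1 / 2 * a * (2 * b) = a * b by intros; ring]
  congr 1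
  refine Finset.sum_congr rfl fun w _ => Finset.sum_congr rfl fun j _ => ?_
  simp only [zeroExtend_of_mem u (l.wordMap_zero_mem n w),
    zeroExtend_of_mem u (l.wordMap_corner_mem n w j)]

lemma sum_word_succ (n : ℕ) (f : Word l n → digits (l.ratio n) → ℝ) :
    ∑ w : Word l (n + 1), f (fun k => w k.castSucc) (w (Fin.last n)) = ∑ w, ∑ s, f w s := by
  rw [Finset.sum_comm, ← Fintype.sum_prod_type']
  exact Fintype.sum_equiv (Fin.snocEquiv fun k : Fin (n + 1) => digits (l.ratio k)).symm _ _
    fun _ => rfl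

/-- Groups the cells by parent, so that consecutive levels can be compared inside each cell of level
`n`. -/
lemma discreteEnergy_succ_eq (n : ℕ) (u : C(carrier l, ℝ)) : discreteEnergy l p (n + 1) u =
    (l.scale n : ℝ) ^ (p - 1) * ∑ w : Word l n, (l.ratio n : ℝ) ^ (p - 1) *
      ∑ s : digits (l.ratio n), starEnergy p fun z =>
        zeroExtend u (wordMap l n w (contraction (l.ratio n) s z)) := by
  rw [discreteEnergy_eq, ← Finset.mul_sum, ← mul_assoc, ← Real.mul_rpow (by positivity)
    (by positivity), scale_succ, Nat.cast_mul, ← sum_word_succ]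
  rfl

theorem monotone_discreteEnergy (hp : 1 < p) (u : C(carrier l, ℝ)) :
    Monotone fun n => discreteEnergy l p n u := by
  refine monotone_nat_of_le_succ fun n => ?_
  rw [discreteEnergy_succ_eq, discreteEnergy_eq]
  refine mul_le_mul_of_nonneg_left (Finset.sum_le_sum fun w _ => ?_) (by positivity)
  exact starEnergy_le_sum hp (l.odd_ratio n) _

lemma discreteEnergy_le_energy {u : C(carrier l, ℝ)}
    (hu : BddAbove (Set.range fun n => discreteEnergy l p n u)) (n : ℕ) :
    discreteEnergy l p n u ≤ energy l p u := le_ciSup hu n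

/-! ### The oscillation of functions of finite energy -/

/-- The path between the two centres stays in one cell, whose share of the energy of level `n + 1`
has the outer weight `(l.scale n) ^ (p - 1)`. Dividing by this weight gives the decay in `n`. -/
lemma abs_sub_center_rpow_le (hp : 1 < p) {u : C(carrier l, ℝ)}
    (hu : BddAbove (Set.range fun n => discreteEnergy l p n u)) (n : ℕ) (w : Word l (n + 1)) :
    |zeroExtend u (wordMap l n (fun k => w k.castSucc) 0) -
        zeroExtend u (wordMap l (n + 1) w 0)| ^ p ≤
      energy l p u * ((1 / 3 : ℝ) ^ (p - 1)) ^ n := by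
  set w' : Word l n := fun k => w k.castSucc
  have h1 := abs_sub_digit_rpow_le_sum hp (l.odd_ratio n)
    (fun z => zeroExtend u (wordMap l n w' z)) (w (Fin.last n)).2
  have h2 : wordMap l (n + 1) w 0 = wordMap l n w' (w (Fin.last n)) := by
    rw [wordMap, contraction, zero_div, add_zero]
  rw [h2]
  refine h1.trans ?_
  have h3 := discreteEnergy_le_energy hu (n + 1)
  rw [discreteEnergy_succ_eq] at h3
  have hnn : ∀ w : Word l n, 0 ≤ (l.ratio n : ℝ) ^ (p - 1) *
      ∑ s : digits (l.ratio n), starEnergy p fun z =>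
        zeroExtend u (wordMap l n w (contraction (l.ratio n) s z)) := fun w =>
    mul_nonneg (by positivity) (Finset.sum_nonneg fun _ _ => starEnergy_nonneg _ _)
  have h4 := Finset.single_le_sum (f := fun w : Word l n => (l.ratio n : ℝ) ^ (p - 1) *
      ∑ s : digits (l.ratio n), starEnergy p fun z =>
        zeroExtend u (wordMap l n w (contraction (l.ratio n) s z)))
    (fun w _ => hnn w) (Finset.mem_univ w')
  refine h4.trans ?_
  have h5 : (1 : ℝ) ≤ ((1 / 3 : ℝ) ^ (p - 1)) ^ n * (l.scale n : ℝ) ^ (p - 1) := by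
    rw [← Real.rpow_mul_natCast (by norm_num), mul_comm (p - 1), Real.rpow_mul (by norm_num),
      Real.rpow_natCast, ← Real.mul_rpow (by positivity) (by positivity)]
    refine Real.one_le_rpow ?_ (by linarith)
    rw [one_div, inv_pow, ← div_eq_inv_mul, one_le_div (by positivity)]
    exact_mod_cast l.three_pow_le_scale n
  have h6 := mul_le_mul_of_nonneg_left h3 (by positivity : 0 ≤ ((1 / 3 : ℝ) ^ (p - 1)) ^ n)
  rw [← mul_assoc] at h6
  rw [mul_comm (energy l p u)]
  refine le_trans ?_ h6
  exact le_mul_of_one_le_left (Finset.sum_nonneg fun w _ => hnn w) h5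

lemma zero_mem_carrier (l : VicsekScale) : (0 : ℂ) ∈ carrier l :=
  l.wordMap_zero_mem 0 fun k => k.elim0

lemma exists_tendsto_center (x : carrier l) : ∃ w : (n : ℕ) → Word l n,
    Tendsto (fun n => (⟨_, l.wordMap_zero_mem n (w n)⟩ : carrier l)) atTop (𝓝 x) := by
  choose w hw using fun n => Set.mem_iUnion.1 (Set.mem_iInter.1 x.2 n)
  refine ⟨w, tendsto_iff_dist_tendsto_zero.2 ?_⟩
  refine squeeze_zero (fun _ => dist_nonneg)
    (fun n => dist_le_of_mem_cell l ⟨0, zero_mem_square, rfl⟩ (hw n)) ?_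
  have := (tendsto_pow_atTop_nhds_zero_of_lt_one (by norm_num : (0 : ℝ) ≤ 1 / 3)
    (by norm_num)).const_mul 2
  rw [mul_zero] at this
  refine this.congr fun n => ?_
  rw [one_div, inv_pow, div_eq_mul_inv]

/-- The oscillation of a function is controlled by its energy. -/
theorem exists_abs_sub_le (hp : 1 < p) : ∃ C : ℝ, 0 < C ∧ ∀ (l : VicsekScale)
    (u : C(carrier l, ℝ)), BddAbove (Set.range fun n => discreteEnergy l p n u) →
      ∀ x y, |u x - u y| ≤ C * energy l p u ^ (1 / p) := by
  have hp0 : 0 < p := by linarith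
  -- The ratio of the geometric series of increments. It is below `1` because `p > 1`, and depends
  -- only on `p` since only `l.ratio k ≥ 3` is used.
  set θ : ℝ := ((1 / 3 : ℝ) ^ (p - 1)) ^ (1 / p) with hθ
  have hθ0 : 0 ≤ θ := by positivity
  have hθ1 : θ < 1 := Real.rpow_lt_one (by positivity)
    (Real.rpow_lt_one (by norm_num) (by norm_num) (by linarith)) (by positivity)
  have hC : 0 < (1 - θ)⁻¹ := inv_pos.2 (by linarith)
  -- Twice the sum of the series: both points are compared with the origin.
  refine ⟨2 * (1 - θ)⁻¹, by positivity, fun l u hu => ?_⟩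
  have hE := energy_nonneg (l := l) (p := p) u
  set A := energy l p u ^ (1 / p) with hA
  have hA0 : 0 ≤ A := by positivity
  have hstep : ∀ n (w : Word l (n + 1)),
      |zeroExtend u (wordMap l n (fun k => w k.castSucc) 0) -
        zeroExtend u (wordMap l (n + 1) w 0)| ≤ A * θ ^ n := by
    intro n w
    have h1 := Real.rpow_le_rpow (by positivity) (abs_sub_center_rpow_le hp hu n w)
      (by positivity : 0 ≤ 1 / p)
    rw [← Real.rpow_mul (abs_nonneg _), mul_one_div_cancel hp0.ne', Real.rpow_one,
      Real.mul_rpow hE (by positivity)] at h1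
    refine h1.trans_eq ?_
    rw [hA, hθ, Real.rpow_pow_comm (Real.rpow_nonneg (by norm_num) _)]
  have hchain : ∀ n (w : Word l n), |zeroExtend u 0 - zeroExtend u (wordMap l n w 0)| ≤
      A * ∑ k ∈ Finset.range n, θ ^ k := by
    intro n
    induction n with
    | zero => intro w; simp [wordMap]
    | succ n ih =>
      intro w
      rw [Finset.sum_range_succ, mul_add]
      exact (abs_sub_le _ _ _).trans (add_le_add (ih fun k => w k.castSucc) (hstep n w))
  have hzero : ∀ x : carrier l, |u ⟨0, l.zero_mem_carrier⟩ - u x| ≤ (1 - θ)⁻¹ * A := by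
    intro x
    obtain ⟨w, hw⟩ := exists_tendsto_center x
    have h1 := (tendsto_const_nhds (x := u ⟨0, l.zero_mem_carrier⟩)).sub
      ((u.continuous.tendsto x).comp hw)
    refine le_of_tendsto h1.abs (Eventually.of_forall fun n => ?_)
    have h2 := hchain n (w n)
    rw [zeroExtend_of_mem u l.zero_mem_carrier,
      zeroExtend_of_mem u (l.wordMap_zero_mem n (w n))] at h2
    refine h2.trans ?_
    rw [mul_comm]
    refine mul_le_mul_of_nonneg_right ?_ hA0
    rw [← tsum_geometric_of_lt_one hθ0 hθ1]
    exact (summable_geometric_of_lt_one hθ0 hθ1).sum_le_tsum _ fun _ _ => by positivity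
  intro x y
  have h1 := abs_sub_le (u x) (u ⟨0, l.zero_mem_carrier⟩) (u y)
  have h2 := hzero x
  have h3 := hzero y
  rw [abs_sub_comm] at h2
  linarith

/-! ### The energy as a limit -/

section

variable {l : VicsekScale} {p : ℝ}

/-- The `p`-th power of the `L^p` norm. -/
noncomputable def lpPow (p : ℝ) (u : C(carrier l, ℝ)) : ℝ := ∫ x, |u x| ^ p ∂(measure l)

lemma lpPow_nonneg (u : C(carrier l, ℝ)) : 0 ≤ lpPow p u :=
  integral_nonneg fun x => by positivity

/-- Stated at a fixed level because a difference of energies occurs, which passes to limits but not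
to suprema. -/
lemma discreteEnergy_half_sub_le {ε C : ℝ}
    (h : ∀ a b : ℝ, |(a - b) / 2| ^ p ≤
      ε * ((|a| ^ p + |b| ^ p) / 2) + C * ((|a| ^ p + |b| ^ p) / 2 - |(a + b) / 2| ^ p))
    (n : ℕ) (u v : C(carrier l, ℝ)) : discreteEnergy l p n ((2⁻¹ : ℝ) • (u - v)) ≤
      ε * ((discreteEnergy l p n u + discreteEnergy l p n v) / 2) +
        C * ((discreteEnergy l p n u + discreteEnergy l p n v) / 2 -
          discreteEnergy l p n ((2⁻¹ : ℝ) • (u + v))) := by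
  simp only [discreteEnergy]
  set W : ℝ := 1 / 2 * ∏ k ∈ Finset.range n, (l.ratio k : ℝ) ^ (p - 1)
  have hW : 0 ≤ W := by positivity
  have key : ∑ e ∈ edges l n, |((2⁻¹ : ℝ) • (u - v)) e.1 - ((2⁻¹ : ℝ) • (u - v)) e.2| ^ p ≤
      ∑ e ∈ edges l n, (ε * ((|u e.1 - u e.2| ^ p + |v e.1 - v e.2| ^ p) / 2) +
        C * ((|u e.1 - u e.2| ^ p + |v e.1 - v e.2| ^ p) / 2 -
          |((2⁻¹ : ℝ) • (u + v)) e.1 - ((2⁻¹ : ℝ) • (u + v)) e.2| ^ p)) := by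
    refine Finset.sum_le_sum fun e _ => ?_
    have := h (u e.1 - u e.2) (v e.1 - v e.2)
    simp only [ContinuousMap.smul_apply, ContinuousMap.sub_apply, ContinuousMap.add_apply,
      smul_eq_mul]
    rwa [show 2⁻¹ * (u e.1 - v e.1) - 2⁻¹ * (u e.2 - v e.2)
        = (u e.1 - u e.2 - (v e.1 - v e.2)) / 2 by ring,
      show 2⁻¹ * (u e.1 + v e.1) - 2⁻¹ * (u e.2 + v e.2)
        = (u e.1 - u e.2 + (v e.1 - v e.2)) / 2 by ring]
  refine (mul_le_mul_of_nonneg_left key hW).trans_eq ?_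
  simp only [Finset.sum_add_distrib, ← Finset.mul_sum, Finset.sum_sub_distrib, ← Finset.sum_div]
  ring

variable [hp : Fact (1 < p)]

lemma energy_le_of_forall {u : C(carrier l, ℝ)} {M : ℝ} (h : ∀ n, discreteEnergy l p n u ≤ M) :
    u ∈ energyDomain l p ∧ energy l p u ≤ M :=
  ⟨⟨M, by rintro _ ⟨n, rfl⟩; exact h n⟩, ciSup_le h⟩

lemma tendsto_discreteEnergy {u : C(carrier l, ℝ)} (hu : u ∈ energyDomain l p) :
    Tendsto (fun n => discreteEnergy l p n u) atTop (𝓝 (energy l p u)) :=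
  tendsto_atTop_ciSup (monotone_discreteEnergy hp.out u) hu

lemma continuous_discreteEnergy (n : ℕ) :
    Continuous fun u : C(carrier l, ℝ) => discreteEnergy l p n u := by
  have hp0 : 0 ≤ p := by linarith [hp.out]
  refine continuous_const.mul (continuous_finsetSum _ fun e _ => ?_)
  exact (((continuous_eval_const e.1).sub (continuous_eval_const e.2)).abs).rpow_const
    fun _ => Or.inr hp0

lemma continuous_abs_rpow (u : C(carrier l, ℝ)) : Continuous fun x => |u x| ^ p :=
  u.continuous.abs.rpow_const fun _ => Or.inr (by linarith [hp.out])

lemma integrable_abs_rpow (u : C(carrier l, ℝ)) :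
    Integrable (fun x => |u x| ^ p) (measure l) :=
  (continuous_abs_rpow u).integrable_of_hasCompactSupport (HasCompactSupport.of_compactSpace _)

/-- Composition with `|·| ^ p` is continuous for uniform convergence, and so are the embedding into
`L^1` and the integral. -/
lemma continuous_lpPow : Continuous fun u : C(carrier l, ℝ) => lpPow p u := by
  have hp0 : 0 ≤ p := by linarith [hp.out]
  set φ : C(ℝ, ℝ) := ⟨fun t => |t| ^ p, continuous_abs.rpow_const fun _ => Or.inr hp0⟩
  have h1 : Continuous fun u : C(carrier l, ℝ) =>
      ∫ x, ContinuousMap.toLp (E := ℝ) 1 (measure l) ℝ (φ.comp u) x ∂(measure l) :=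
    continuous_integral.comp
      ((ContinuousMap.toLp (E := ℝ) 1 (measure l) ℝ).continuous.comp
        (ContinuousMap.continuous_postcomp φ))
  refine h1.congr fun u => integral_congr_ae ?_
  exact ContinuousMap.coeFn_toLp (𝕜 := ℝ) (measure l) (φ.comp u)

/-- The approximation of the `p`-th power of the norm of `F_p` by the discrete energy. -/
noncomputable def levelPow (p : ℝ) (n : ℕ) (u : C(carrier l, ℝ)) : ℝ :=
  lpPow p u + discreteEnergy l p n u

lemma continuous_levelPow (n : ℕ) : Continuous fun u : C(carrier l, ℝ) => levelPow p n u :=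
  continuous_lpPow.add (continuous_discreteEnergy n)

variable (p) in
/-- The element of `F_p` given by a function of finite energy. -/
def Sobolev.ofMem (u : C(carrier l, ℝ)) (hu : u ∈ energyDomain l p) : Sobolev l p :=
  (⟨u, hu⟩ : energyDomain l p)

lemma Sobolev.toFun_ofMem (u : C(carrier l, ℝ)) (hu : u ∈ energyDomain l p) :
    (Sobolev.ofMem p u hu).toFun = u := rfl

lemma Sobolev.norm_rpow (u : Sobolev l p) : ‖u‖ ^ p = lpPow p u.toFun + energy l p u.toFun := by
  have hp0 : 0 < p := by linarith [hp.out]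
  have h : 0 ≤ lpPow p u.toFun + energy l p u.toFun :=
    add_nonneg (lpPow_nonneg _) (energy_nonneg _)
  rw [Sobolev.norm_def, ← lpPow, ← Real.rpow_mul h, one_div_mul_cancel hp0.ne', Real.rpow_one]

lemma Sobolev.tendsto_levelPow (u : Sobolev l p) :
    Tendsto (fun n => levelPow p n u.toFun) atTop (𝓝 (‖u‖ ^ p)) := by
  rw [Sobolev.norm_rpow]
  exact tendsto_const_nhds.add (tendsto_discreteEnergy u.2)

lemma Sobolev.levelPow_le (u : Sobolev l p) (n : ℕ) : levelPow p n u.toFun ≤ ‖u‖ ^ p := by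
  rw [Sobolev.norm_rpow]
  exact add_le_add_right (discreteEnergy_le_energy u.2 n) _

/-! ### Uniform convexity -/

lemma lpPow_half_sub_le {ε C : ℝ}
    (h : ∀ a b : ℝ, |(a - b) / 2| ^ p ≤
      ε * ((|a| ^ p + |b| ^ p) / 2) + C * ((|a| ^ p + |b| ^ p) / 2 - |(a + b) / 2| ^ p))
    (u v : C(carrier l, ℝ)) : lpPow p ((2⁻¹ : ℝ) • (u - v)) ≤
      ε * ((lpPow p u + lpPow p v) / 2) +
        C * ((lpPow p u + lpPow p v) / 2 - lpPow p ((2⁻¹ : ℝ) • (u + v))) := by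
  have hi : Integrable (fun x => (|u x| ^ p + |v x| ^ p) / 2) (measure l) :=
    ((integrable_abs_rpow u).add (integrable_abs_rpow v)).div_const 2
  have hs := integrable_abs_rpow (p := p) ((2⁻¹ : ℝ) • (u + v))
  have hd : Integrable (fun x => (|u x| ^ p + |v x| ^ p) / 2 -
      |((2⁻¹ : ℝ) • (u + v)) x| ^ p) (measure l) := hi.sub hs
  calc lpPow p ((2⁻¹ : ℝ) • (u - v)) ≤ ∫ x, (ε * ((|u x| ^ p + |v x| ^ p) / 2) +
        C * ((|u x| ^ p + |v x| ^ p) / 2 - |((2⁻¹ : ℝ) • (u + v)) x| ^ p)) ∂(measure l) := by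
        refine integral_mono (integrable_abs_rpow _)
          ((hi.const_mul ε).add (hd.const_mul C)) fun x => ?_
        have := h (u x) (v x)
        simp only [ContinuousMap.smul_apply, ContinuousMap.sub_apply, ContinuousMap.add_apply,
          smul_eq_mul]
        rwa [← div_eq_inv_mul, ← div_eq_inv_mul]
    _ = _ := by
        rw [integral_add (hi.const_mul ε) (hd.const_mul C), integral_const_mul,
          integral_const_mul, integral_sub hi hs, integral_div,
          integral_add (integrable_abs_rpow u) (integrable_abs_rpow v)]
        rfl

/-- The limit in the level of the integral and edge inequalities added together; monotonicity makes
the discrete energies converge. -/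
lemma Sobolev.exists_norm_half_sub_le {ε : ℝ} (hε : 0 < ε) : ∃ C : ℝ, 0 < C ∧
    ∀ u v : Sobolev l p, (‖u - v‖ / 2) ^ p ≤
      ε * ((‖u‖ ^ p + ‖v‖ ^ p) / 2) + C * ((‖u‖ ^ p + ‖v‖ ^ p) / 2 - (‖u + v‖ / 2) ^ p) := by
  obtain ⟨C, hC, h⟩ := exists_abs_half_sub_rpow_le hp.out hε
  refine ⟨C, hC, fun u v => ?_⟩
  have hhalf : ∀ w : Sobolev l p, ‖w‖ / 2 = ‖(2⁻¹ : ℝ) • w‖ := fun w => by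
    rw [norm_smul, norm_inv, Real.norm_two, div_eq_inv_mul]
  rw [hhalf, hhalf]
  refine le_of_tendsto_of_tendsto' (Sobolev.tendsto_levelPow _)
    ((((u.tendsto_levelPow.add v.tendsto_levelPow).div_const 2).const_mul ε).add
      ((((u.tendsto_levelPow.add v.tendsto_levelPow).div_const 2).sub
        (Sobolev.tendsto_levelPow _)).const_mul C)) fun n => ?_
  have h1 := lpPow_half_sub_le h u.toFun v.toFun
  have h2 := discreteEnergy_half_sub_le h n u.toFun v.toFun
  refine (add_le_add h1 h2).trans_eq ?_
  simp only [levelPow]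
  rw [show ((2⁻¹ : ℝ) • (u + v)).toFun = (2⁻¹ : ℝ) • (u.toFun + v.toFun) from rfl]
  ring

instance Sobolev.uniformConvexSpace : UniformConvexSpace (Sobolev l p) :=
  uniformConvexSpace_of_rpow hp.out fun _ hε => Sobolev.exists_norm_half_sub_le hε

/-! ### Completeness -/

lemma Sobolev.exists_norm_toFun_le (l : VicsekScale) (p : ℝ) [hp : Fact (1 < p)] :
    ∃ C : ℝ, 0 < C ∧ ∀ u : Sobolev l p, ‖u.toFun‖ ≤ C * ‖u‖ := by
  have hp0 : 0 < p := by linarith [hp.out]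
  obtain ⟨C, hC, hosc⟩ := exists_abs_sub_le hp.out
  refine ⟨1 + C, by positivity, fun u => ?_⟩
  have hmono : ∀ a : ℝ, 0 ≤ a → a ≤ ‖u‖ ^ p → a ^ (1 / p) ≤ ‖u‖ := fun a ha h => by
    have := Real.rpow_le_rpow ha h (by positivity : 0 ≤ 1 / p)
    rwa [← Real.rpow_mul (norm_nonneg _), mul_one_div_cancel hp0.ne', Real.rpow_one] at this
  have hnorm := u.norm_rpow
  have hE : energy l p u.toFun ^ (1 / p) ≤ ‖u‖ :=
    hmono _ (energy_nonneg _) (by rw [hnorm]; linarith [lpPow_nonneg (p := p) u.toFun])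
  have hI : lpPow p u.toFun ^ (1 / p) ≤ ‖u‖ :=
    hmono _ (lpPow_nonneg _) (by rw [hnorm]; linarith [energy_nonneg (p := p) u.toFun])
  -- At a minimum point of `|u|` the value is at most the `L^p` norm, as the measure has mass one;
  -- the oscillation bound does the rest.
  obtain ⟨y, -, hy⟩ := isCompact_univ.exists_isMinOn ⟨(⟨0, l.zero_mem_carrier⟩ : carrier l),
    Set.mem_univ _⟩ u.toFun.continuous.abs.continuousOn
  have hy' : |u.toFun y| ≤ ‖u‖ := by
    refine le_trans ?_ hI
    have h1 : |u.toFun y| ^ p ≤ lpPow p u.toFun := by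
      have := integral_mono (μ := measure l) (integrable_const (|u.toFun y| ^ p))
        (integrable_abs_rpow u.toFun) fun x =>
          Real.rpow_le_rpow (abs_nonneg _) (hy (Set.mem_univ x)) hp0.le
      rw [lpPow]
      simpa using this
    have := Real.rpow_le_rpow (by positivity) h1 (by positivity : 0 ≤ 1 / p)
    rwa [← Real.rpow_mul (abs_nonneg _), mul_one_div_cancel hp0.ne', Real.rpow_one] at this
  refine (ContinuousMap.norm_le _ (by positivity)).2 fun x => ?_
  have h1 := hosc l u.toFun u.2 x y
  have h2 : |u.toFun x| ≤ |u.toFun x - u.toFun y| + |u.toFun y| := by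
    simpa using abs_add_le (u.toFun x - u.toFun y) (u.toFun y)
  rw [Real.norm_eq_abs]
  have h3 := mul_le_mul_of_nonneg_left hE hC.le
  linarith

/-- Reduces norm bounds to fixed levels, where `levelPow` is continuous for uniform convergence; in
effect, lower semicontinuity of the norm. -/
lemma Sobolev.norm_le_of_levelPow_le {u : C(carrier l, ℝ)} {ε : ℝ} (hε : 0 ≤ ε)
    (h : ∀ n, levelPow p n u ≤ ε ^ p) :
    ∃ hu : u ∈ energyDomain l p, ‖Sobolev.ofMem p u hu‖ ≤ ε := by
  have hp0 : 0 < p := by linarith [hp.out]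
  obtain ⟨hu, hE⟩ := energy_le_of_forall (u := u) (p := p) (M := ε ^ p - lpPow p u) fun n => by
    have := h n
    rw [levelPow] at this
    linarith
  refine ⟨hu, ?_⟩
  rw [← Real.rpow_le_rpow_iff (norm_nonneg _) hε hp0, Sobolev.norm_rpow, Sobolev.toFun_ofMem]
  linarith

instance Sobolev.completeSpace : CompleteSpace (Sobolev l p) := by
  have hp0 : 0 < p := by linarith [hp.out]
  refine Metric.complete_of_cauchySeq_tendsto fun u hu => ?_
  obtain ⟨C, hC, hsup⟩ := Sobolev.exists_norm_toFun_le l p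
  have hcauchy : CauchySeq fun k => (u k).toFun := by
    rw [Metric.cauchySeq_iff] at hu ⊢
    intro ε hε
    obtain ⟨N, hN⟩ := hu (ε / C) (by positivity)
    refine ⟨N, fun m hm k hk => ?_⟩
    have h1 := hN m hm k hk
    rw [dist_eq_norm, lt_div_iff₀ hC] at h1
    have h2 := hsup (u m - u k)
    rw [dist_eq_norm]
    calc ‖(u m).toFun - (u k).toFun‖ = ‖(u m - u k).toFun‖ := rfl
      _ ≤ C * ‖u m - u k‖ := h2
      _ < ε := by linarith
  obtain ⟨f, hf⟩ := cauchySeq_tendsto_of_complete hcauchy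
  have key : ∀ ε : ℝ, 0 < ε → ∃ N, ∀ k ≥ N, ∃ hk : f - (u k).toFun ∈ energyDomain l p,
      ‖Sobolev.ofMem p _ hk‖ ≤ ε := by
    intro ε hε
    obtain ⟨N, hN⟩ := Metric.cauchySeq_iff.1 hu ε hε
    refine ⟨N, fun k hk => Sobolev.norm_le_of_levelPow_le hε.le fun n => ?_⟩
    -- The level `n` is fixed while the index `m` of the Cauchy sequence tends to infinity.
    refine le_of_tendsto (((continuous_levelPow n).tendsto _).comp
      (hf.sub tendsto_const_nhds)) ?_
    filter_upwards [eventually_ge_atTop N] with m hm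
    have h1 := hN m hm k hk
    rw [dist_eq_norm] at h1
    exact ((u m - u k).levelPow_le n).trans (Real.rpow_le_rpow (norm_nonneg _) h1.le hp0.le)
  have hfmem : f ∈ energyDomain l p := by
    obtain ⟨N, hN⟩ := key 1 one_pos
    obtain ⟨h1, -⟩ := hN N le_rfl
    have := (energyDomain l p).add_mem h1 (u N).2
    rwa [show (f - (u N).toFun) + (u N).1 = f from sub_add_cancel _ _] at this
  refine ⟨Sobolev.ofMem p f hfmem, Metric.tendsto_atTop.2 fun ε hε => ?_⟩
  obtain ⟨N, hN⟩ := key (ε / 2) (by positivity)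
  refine ⟨N, fun k hk => ?_⟩
  obtain ⟨h1, h2⟩ := hN k hk
  rw [dist_comm, dist_eq_norm]
  exact lt_of_le_of_lt h2 (by linarith)

/-! ### Separability -/

/-- A Radon–Riesz argument. The midpoints of `u` and `d i` converge uniformly to `u`, so one
well-chosen level bounds their norms from below. Norms almost equal to that of the midpoint then
force `u` and `d i` together by convexity. -/
lemma Sobolev.exists_norm_sub_lt {u : Sobolev l p} {d : ℕ → Sobolev l p}
    (hd : Tendsto (fun i => (d i).toFun) atTop (𝓝 u.toFun))
    (hd' : Tendsto (fun i => ‖d i‖ ^ p) atTop (𝓝 (‖u‖ ^ p))) {η : ℝ} (hη : 0 < η) :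
    ∃ i, ‖u - d i‖ < η := by
  have hp0 : 0 < p := by linarith [hp.out]
  set A := ‖u‖ ^ p with hA
  have hA0 : 0 ≤ A := by positivity
  set t := (η / 2) ^ p with ht
  have ht0 : 0 < t := Real.rpow_pos_of_pos (by positivity) _
  -- This makes the `ε`-term at most `t / 4`. The defect will be at most `3 / 2 * ε` for the `ε` set
  -- below, costing at most `3 / 8 * t`; the total stays below `t`.
  obtain ⟨C, hC, hconv⟩ := Sobolev.exists_norm_half_sub_le (l := l) (p := p)
    (ε := t / (4 * (A + 1))) (by positivity)
  set ε := min 1 (t / (4 * C)) with hε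
  have hε0 : 0 < ε := by positivity
  have hε1 : ε ≤ 1 := min_le_left _ _
  have hεC : C * ε ≤ t / 4 := by
    have : ε ≤ t / (4 * C) := min_le_right _ _
    calc C * ε ≤ C * (t / (4 * C)) := by gcongr
      _ = t / 4 := by field_simp
  obtain ⟨n, hn⟩ := (u.tendsto_levelPow.eventually (lt_mem_nhds (show A - ε < A by linarith))).exists
  have hmid : Tendsto (fun i => levelPow p n ((2⁻¹ : ℝ) • (u.toFun + (d i).toFun))) atTop
      (𝓝 (levelPow p n u.toFun)) := by
    have h1 : Tendsto (fun i => (2⁻¹ : ℝ) • (u.toFun + (d i).toFun)) atTop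
        (𝓝 ((2⁻¹ : ℝ) • (u.toFun + u.toFun))) := (tendsto_const_nhds.add hd).const_smul _
    rw [← two_smul ℝ u.toFun, smul_smul, inv_mul_cancel₀ two_ne_zero, one_smul] at h1
    exact ((continuous_levelPow n).tendsto _).comp h1
  obtain ⟨i, hi1, hi2⟩ := ((hmid.eventually (lt_mem_nhds hn)).and
    (hd'.eventually (gt_mem_nhds (show A < A + ε by linarith)))).exists
  refine ⟨i, ?_⟩
  have h1 : A - ε < (‖u + d i‖ / 2) ^ p := by
    have h2 := ((2⁻¹ : ℝ) • (u + d i)).levelPow_le n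
    rw [norm_smul, norm_inv, Real.norm_two, ← div_eq_inv_mul] at h2
    exact hi1.trans_le h2
  have h3 := hconv u (d i)
  have h4 : t / (4 * (A + 1)) * ((A + ‖d i‖ ^ p) / 2) ≤ t / 4 := by
    calc t / (4 * (A + 1)) * ((A + ‖d i‖ ^ p) / 2) ≤ t / (4 * (A + 1)) * (A + 1) := by
          gcongr; linarith
      _ = t / 4 := by field_simp
  have h5 : C * ((A + ‖d i‖ ^ p) / 2 - (‖u + d i‖ / 2) ^ p) ≤ C * (3 / 2 * ε) := by
    gcongr; linarith
  have h6 : (‖u - d i‖ / 2) ^ p < (η / 2) ^ p := by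
    rw [← ht]
    linarith
  have h7 := (Real.rpow_lt_rpow_iff (by positivity) (by positivity) hp0).1 h6
  linarith

/-- The range of `Ψ` is a subset of a separable metric space, so it has a countable dense subset;
convergence of `Ψ` is just what `Sobolev.exists_norm_sub_lt` requires. -/
instance Sobolev.separableSpace : TopologicalSpace.SeparableSpace (Sobolev l p) := by
  set Ψ : Sobolev l p → C(carrier l, ℝ) × ℝ := fun u => (u.toFun, ‖u‖ ^ p)
  obtain ⟨t, htΨ, htc, hdense⟩ :=
    (TopologicalSpace.IsSeparable.of_separableSpace (Set.range Ψ)).exists_countable_dense_subset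
  choose! g hg using fun y (hy : y ∈ t) => htΨ hy
  refine ⟨⟨g '' t, htc.image g, fun u => Metric.mem_closure_iff.2 fun η hη => ?_⟩⟩
  obtain ⟨y, hyt, hy⟩ := mem_closure_iff_seq_limit.1 (hdense ⟨u, rfl⟩)
  have hd : ∀ i, Ψ (g (y i)) = y i := fun i => hg _ (hyt i)
  have h1 : Tendsto (fun i => Ψ (g (y i))) atTop (𝓝 (Ψ u)) := by simpa only [hd] using hy
  obtain ⟨i, hi⟩ := Sobolev.exists_norm_sub_lt (u := u) (d := fun i => g (y i))
    ((continuous_fst.tendsto _).comp h1) ((continuous_snd.tendsto _).comp h1) hη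
  exact ⟨_, ⟨y i, hyt i, rfl⟩, by rwa [dist_eq_norm]⟩

/-! ### Products, contractions, spectral gap and locality -/

lemma mul_mem_energyDomain {u v : C(carrier l, ℝ)} (hu : u ∈ energyDomain l p)
    (hv : v ∈ energyDomain l p) : u * v ∈ energyDomain l p ∧ energy l p (u * v) ≤
      2 ^ (p - 1) * (‖u‖ ^ p * energy l p v + ‖v‖ ^ p * energy l p u) := by
  have hp0 : 0 < p := by linarith [hp.out]
  refine energy_le_of_forall fun n => ?_
  have hedge : ∀ e : carrier l × carrier l, |(u * v) e.1 - (u * v) e.2| ^ p ≤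
      2 ^ (p - 1) * (‖u‖ ^ p * |v e.1 - v e.2| ^ p + ‖v‖ ^ p * |u e.1 - u e.2| ^ p) := by
    intro e
    have h1 : |(u * v) e.1 - (u * v) e.2| ≤
        ‖u‖ * |v e.1 - v e.2| + ‖v‖ * |u e.1 - u e.2| := by
      have : (u * v) e.1 - (u * v) e.2 = u e.1 * (v e.1 - v e.2) + v e.2 * (u e.1 - u e.2) := by
        simp only [ContinuousMap.mul_apply]; ring
      rw [this]
      refine (abs_add_le _ _).trans ?_
      rw [abs_mul, abs_mul]
      gcongr
      · exact u.norm_coe_le_norm e.1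
      · exact v.norm_coe_le_norm e.2
    have h2 := Real.rpow_sum_le_const_mul_sum_rpow_of_nonneg (s := (Finset.univ : Finset (Fin 2)))
      (f := ![‖u‖ * |v e.1 - v e.2|, ‖v‖ * |u e.1 - u e.2|]) hp.out.le
      (by simp only [Finset.mem_univ, true_implies, Fin.forall_fin_two]
          exact ⟨by simp; positivity, by simp; positivity⟩)
    simp only [Fin.sum_univ_two, Finset.card_univ, Fintype.card_fin, Matrix.cons_val_zero,
      Matrix.cons_val_one, Nat.cast_ofNat] at h2
    refine (Real.rpow_le_rpow (abs_nonneg _) h1 hp0.le).trans (h2.trans_eq ?_)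
    rw [Real.mul_rpow (norm_nonneg _) (abs_nonneg _), Real.mul_rpow (norm_nonneg _) (abs_nonneg _)]
  have h1 : discreteEnergy l p n (u * v) ≤ 2 ^ (p - 1) *
      (‖u‖ ^ p * discreteEnergy l p n v + ‖v‖ ^ p * discreteEnergy l p n u) := by
    simp only [discreteEnergy]
    set W : ℝ := 1 / 2 * ∏ k ∈ Finset.range n, (l.ratio k : ℝ) ^ (p - 1)
    have hW : 0 ≤ W := by positivity
    refine (mul_le_mul_of_nonneg_left (Finset.sum_le_sum fun e _ => hedge e) hW).trans_eq ?_
    simp only [Finset.sum_add_distrib, ← Finset.mul_sum]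
    ring
  refine h1.trans ?_
  have h2 := discreteEnergy_le_energy hu n
  have h3 := discreteEnergy_le_energy hv n
  gcongr

lemma comp_mem_energyDomain {u : C(carrier l, ℝ)} (hu : u ∈ energyDomain l p) (φ : ℝ → ℝ)
    (hφ : LipschitzWith 1 φ) :
    (ContinuousMap.mk φ hφ.continuous).comp u ∈ energyDomain l p ∧
      energy l p ((ContinuousMap.mk φ hφ.continuous).comp u) ≤ energy l p u := by
  have hp0 : 0 ≤ p := by linarith [hp.out]
  refine energy_le_of_forall fun n => le_trans ?_ (discreteEnergy_le_energy hu n)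
  refine mul_le_mul_of_nonneg_left (Finset.sum_le_sum fun e _ => ?_) (by positivity)
  refine Real.rpow_le_rpow (abs_nonneg _) ?_ hp0
  have := hφ.dist_le_mul (u e.1) (u e.2)
  simpa [Real.dist_eq] using this

lemma corner_mem_carrier (l : VicsekScale) (j : Fin 4) : corner j ∈ carrier l :=
  l.wordMap_corner_mem 0 (fun k => k.elim0) j

lemma diam_carrier_pos (l : VicsekScale) : 0 < Metric.diam (carrier l) := by
  have hb : Bornology.IsBounded (carrier l) :=
    (isCompact_iff_compactSpace.2 inferInstance : IsCompact (carrier l)).isBounded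
  have h := Metric.dist_le_diam_of_mem hb (l.corner_mem_carrier 0) l.zero_mem_carrier
  rw [dist_zero_right, norm_corner] at h
  linarith

theorem exists_spectral_gap (l : VicsekScale) (p : ℝ) [hp : Fact (1 < p)] :
    ∃ C : ℝ, 1 ≤ C ∧ ∀ u ∈ energyDomain l p,
      (∫ x, |u x - (⨍ y, u y ∂l.measure)| ^ p ∂l.measure) ≤
        C * Metric.diam l.carrier ^ (p - 1) * energy l p u := by
  have hp0 : 0 < p := by linarith [hp.out]
  obtain ⟨C, hC, hosc⟩ := exists_abs_sub_le hp.out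
  have hd : 0 < Metric.diam l.carrier ^ (p - 1) := Real.rpow_pos_of_pos l.diam_carrier_pos _
  -- The oscillation bound already gives the constant `C ^ p`; the positive diameter factor is
  -- divided out and the maximum ensures `1 ≤ C`.
  refine ⟨max 1 (C ^ p / Metric.diam l.carrier ^ (p - 1)), le_max_left _ _, fun u hu => ?_⟩
  have hE := energy_nonneg (l := l) (p := p) u
  have hint : Integrable u (measure l) :=
    u.continuous.integrable_of_hasCompactSupport (HasCompactSupport.of_compactSpace _)
  have hmean : ∀ x, |u x - (⨍ y, u y ∂l.measure)| ^ p ≤ C ^ p * energy l p u := by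
    intro x
    have h1 : u x - (⨍ y, u y ∂l.measure) = ∫ y, (u x - u y) ∂l.measure := by
      rw [average_eq_integral, integral_sub (integrable_const _) hint]
      simp
    have h2 : |u x - (⨍ y, u y ∂l.measure)| ≤ C * energy l p u ^ (1 / p) := by
      rw [h1, ← Real.norm_eq_abs]
      have := norm_integral_le_of_norm_le_const (μ := l.measure)
        (f := fun y => u x - u y) (C := C * energy l p u ^ (1 / p))
        (Eventually.of_forall fun y => hosc l u hu x y)
      simpa using this
    refine (Real.rpow_le_rpow (abs_nonneg _) h2 hp0.le).trans_eq ?_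
    rw [Real.mul_rpow hC.le (by positivity), ← Real.rpow_mul hE, one_div_mul_cancel hp0.ne',
      Real.rpow_one]
  have h3 : (∫ x, |u x - (⨍ y, u y ∂l.measure)| ^ p ∂l.measure) ≤ C ^ p * energy l p u := by
    have h4 := integral_mono (μ := l.measure)
      (integrable_abs_rpow (p := p) (u - ContinuousMap.const _ (⨍ y, u y ∂l.measure)))
      (integrable_const (C ^ p * energy l p u)) hmean
    simpa using h4
  refine h3.trans (mul_le_mul_of_nonneg_right ?_ hE)
  rw [← div_le_iff₀ hd]
  exact le_max_right _ _

/-- By compactness a `δ`-neighbourhood of the support of `u` misses that of `v - a`. On an edge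
shorter than `δ` either `u` vanishes at both ends or `v = a` at both, so additivity holds exactly at
all large levels. -/
lemma energy_add_of_tsupport {u v : C(carrier l, ℝ)} (hu : u ∈ energyDomain l p)
    (hv : v ∈ energyDomain l p) {a : ℝ} (h : tsupport u ∩ tsupport (fun x => v x - a) = ∅) :
    energy l p (u + v) = energy l p u + energy l p v := by
  have hp0 : p ≠ 0 := by linarith [hp.out]
  obtain ⟨δ, hδ, hsep⟩ := (isClosed_tsupport u).isCompact.exists_thickening_subset_open
    (isClosed_tsupport fun x => v x - a).isOpen_compl
    (Set.disjoint_iff_inter_eq_empty.2 h).subset_compl_right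
  obtain ⟨N, hN⟩ := exists_pow_lt_of_lt_one hδ (by norm_num : (1 / 3 : ℝ) < 1)
  have hdist : ∀ x y : carrier l, dist x y < δ → x ∈ tsupport u → v x = a ∧ v y = a := by
    intro x y hxy hx
    have aux : ∀ z ∉ tsupport (fun x => v x - a), v z = a := fun z hz =>
      sub_eq_zero.1 (image_eq_zero_of_notMem_tsupport (f := fun x => v x - a) hz)
    refine ⟨aux x (hsep (Metric.self_subset_thickening hδ _ hx)), aux y (hsep ?_)⟩
    exact Metric.mem_thickening_iff.2 ⟨x, hx, by rwa [dist_comm]⟩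
  refine tendsto_nhds_unique (tendsto_discreteEnergy ((energyDomain l p).add_mem hu hv))
    (((tendsto_discreteEnergy hu).add (tendsto_discreteEnergy hv)).congr' ?_)
  filter_upwards [eventually_ge_atTop N] with n hn
  simp only [discreteEnergy]
  rw [← mul_add, ← Finset.sum_add_distrib]
  congr 1
  refine Finset.sum_congr rfl fun ⟨x, y⟩ he => ?_
  have hxy : dist x y < δ := by
    have h1 := (l.mem_edges.1 he).2.2
    rw [Subtype.dist_eq, h1]
    refine lt_of_le_of_lt ?_ hN
    rw [one_div, inv_pow]
    refine inv_anti₀ (by positivity) ?_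
    refine (pow_le_pow_right₀ (by norm_num) hn).trans ?_
    exact_mod_cast l.three_pow_le_scale n
  simp only [ContinuousMap.add_apply]
  by_cases hx : x ∈ tsupport u
  · obtain ⟨h1, h2⟩ := hdist x y hxy hx
    simp [h1, h2, Real.zero_rpow hp0]
  by_cases hy : y ∈ tsupport u
  · obtain ⟨h1, h2⟩ := hdist y x (by rwa [dist_comm]) hy
    simp [h1, h2, Real.zero_rpow hp0]
  · simp [image_eq_zero_of_notMem_tsupport hx, image_eq_zero_of_notMem_tsupport hy,
      Real.zero_rpow hp0]

lemma exists_energy_seminorm (l : VicsekScale) (p : ℝ) [hp : Fact (1 < p)] :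
    ∃ s : Seminorm ℝ (energyDomain l p), ∀ u : energyDomain l p, s u = energy l p u ^ (1 / p) := by
  have hp0 : 0 < p := by linarith [hp.out]
  refine ⟨Seminorm.of (fun u : energyDomain l p => energy l p u ^ (1 / p))
    (fun u v => energy_add (l := l) (p := p) u v) fun c u => ?_, fun _ => rfl⟩
  rw [Submodule.coe_smul, energy_smul, Real.mul_rpow (by positivity) (energy_nonneg _),
    ← Real.rpow_mul (abs_nonneg c), mul_one_div_cancel hp0.ne', Real.rpow_one, Real.norm_eq_abs]

end

variable (l : VicsekScale)

/-! ### Projecting the Vicsek set to an axis -/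

/-- The values of the projection of the Vicsek set to its first axis, in rotated coordinates:
a branch that leaves the axis at the centre `(c, 0)` of a cell of level `k` is mapped to `c`, and
is contained in the two squares described by the inequalities. -/
def IsProjection (x y c : ℝ) : Prop :=
  (y = 0 ∧ c = x) ∨ ∃ (k : ℕ) (a : ℤ), c = 2 * a / l.scale k ∧
    |x - c| ≤ |y| - 1 / l.scale (k + 1) ∧ |x - c| ≤ 1 / l.scale k - |y|

lemma scale_dvd_scale {k m : ℕ} (h : k ≤ m) : l.scale k ∣ l.scale m :=
  Finset.prod_dvd_prod_of_subset _ _ _ (Finset.range_mono h)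

lemma one_div_scale_anti {k m : ℕ} (h : k ≤ m) : 1 / (l.scale m : ℝ) ≤ 1 / l.scale k := by
  have h1 := Nat.le_of_dvd (l.scale_pos m) (l.scale_dvd_scale h)
  have h2 : (0 : ℝ) < l.scale k := by exact_mod_cast l.scale_pos k
  exact one_div_le_one_div_of_le h2 (by exact_mod_cast h1)

/-- Both points are integer multiples of `2 / l.scale m`. -/
lemma le_abs_sub_of_lattice {k m : ℕ} (h : k ≤ m) {a b : ℤ}
    (hne : (2 * a / l.scale k : ℝ) ≠ 2 * b / l.scale m) :
    2 * (1 / (l.scale m : ℝ)) ≤ |(2 * a / l.scale k : ℝ) - 2 * b / l.scale m| := by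
  obtain ⟨r, hr⟩ := l.scale_dvd_scale h
  have hk : (0 : ℝ) < l.scale k := by exact_mod_cast l.scale_pos k
  have hm : (0 : ℝ) < l.scale m := by exact_mod_cast l.scale_pos m
  have hr' : (l.scale m : ℝ) = l.scale k * r := by exact_mod_cast hr
  have h1 : (2 * a / l.scale k : ℝ) - 2 * b / l.scale m
      = 2 * (1 / (l.scale m : ℝ)) * ((a * r - b : ℤ) : ℝ) := by
    push_cast
    field_simp
    rw [hr']
    ring
  have h2 : a * r - b ≠ 0 := by
    intro h0
    rw [h0, Int.cast_zero, mul_zero] at h1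
    exact hne (sub_eq_zero.1 h1)
  have h3 : (1 : ℝ) ≤ |((a * r - b : ℤ) : ℝ)| := by
    exact_mod_cast Int.one_le_abs h2
  rw [h1, abs_mul, abs_of_pos (by positivity)]
  exact le_mul_of_one_le_right (by positivity) h3

variable {l} in
-- Against a point of the axis, `|x - c| ≤ |y|` suffices. For branches of levels `k < m`, the
-- coarser lies above the height `1 / l.scale m` and the finer below it, so `|x - c| + |x' - c'| ≤
-- |y| - |y'|`. At equal levels the two deviations add up to at most `1 / l.scale m`, half the least
-- distance of distinct feet.
lemma IsProjection.abs_sub_le {x y c x' y' c' : ℝ} (h : l.IsProjection x y c)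
    (h' : l.IsProjection x' y' c') : |c - c'| ≤ 2 * (|x - x'| + |y - y'|) := by
  have axis : ∀ {x y c x' : ℝ}, l.IsProjection x y c → |c - x'| ≤ 2 * (|x - x'| + |y|) := by
    rintro x y c x' (⟨-, rfl⟩ | ⟨k, a, -, h1, -⟩)
    · linarith [abs_nonneg (c - x'), abs_nonneg y]
    · have h2 := _root_.abs_sub_le c x x'
      rw [abs_sub_comm c x] at h2
      have : 0 ≤ 1 / (l.scale (k + 1) : ℝ) := by positivity
      linarith [abs_nonneg (x - x'), abs_nonneg y]
  have branch : ∀ {k m : ℕ}, k ≤ m → ∀ {x y c x' y' c' : ℝ} {a b : ℤ},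
      c = 2 * a / l.scale k → |x - c| ≤ |y| - 1 / l.scale (k + 1) → |x - c| ≤ 1 / l.scale k - |y| →
      c' = 2 * b / l.scale m → |x' - c'| ≤ |y'| - 1 / l.scale (m + 1) →
      |x' - c'| ≤ 1 / l.scale m - |y'| → |c - c'| ≤ 2 * (|x - x'| + |y - y'|) := by
    intro k m hkm x y c x' y' c' a b hc h1 h2 hc' h1' h2'
    by_cases hcc : c = c'
    · rw [hcc, sub_self, abs_zero]; positivity
    have h3 : 2 * (1 / (l.scale m : ℝ)) ≤ |c - c'| := by
      rw [hc, hc'] at hcc ⊢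
      exact l.le_abs_sub_of_lattice hkm hcc
    have h4 : |c - c'| ≤ |x - c| + |x - x'| + |x' - c'| := by
      have h5 := _root_.abs_sub_le c x c'
      have h6 := _root_.abs_sub_le x x' c'
      rw [abs_sub_comm c x] at h5
      linarith
    have hp1 : 0 ≤ 1 / (l.scale (k + 1) : ℝ) := by positivity
    have hp2 : 0 ≤ 1 / (l.scale (m + 1) : ℝ) := by positivity
    have hx := abs_nonneg (x - x')
    have hy := abs_nonneg (y - y')
    rcases hkm.eq_or_lt with rfl | hlt
    · linarith
    · have h5 := l.one_div_scale_anti (Nat.succ_le_of_lt hlt)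
      have h6 := abs_sub_abs_le_abs_sub y y'
      have h7 : |y'| ≤ 1 / (l.scale m : ℝ) := by linarith [abs_nonneg (x' - c')]
      have h8 : 1 / (l.scale m : ℝ) ≤ 1 / l.scale (k + 1) := h5
      linarith
  rcases h with ⟨rfl, rfl⟩ | ⟨k, a, hc, h1, h2⟩
  · have := axis (x' := c) h'
    rw [abs_sub_comm c' c, abs_sub_comm x' c] at this
    rwa [zero_sub, abs_neg]
  · rcases h' with ⟨rfl, rfl⟩ | ⟨m, b, hc', h1', h2'⟩
    · rw [sub_zero]
      exact axis (Or.inr ⟨k, a, hc, h1, h2⟩)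
    · rcases le_total k m with hkm | hkm
      · exact branch hkm hc h1 h2 hc' h1' h2'
      · rw [abs_sub_comm c, abs_sub_comm x, abs_sub_comm y]
        exact branch hkm hc' h1' h2' hc h1 h2

/-- The projection of the Vicsek set to its first axis extends to a Lipschitz function on the
plane. -/
lemma exists_lipschitz_projection : ∃ h : ℂ → ℝ, LipschitzWith 4 h ∧
    ∀ z c, l.IsProjection z.re z.im c → h z = c := by
  classical
  set A : Set ℂ := {z | ∃ c, l.IsProjection z.re z.im c}
  choose! f hf using fun z (hz : z ∈ A) => hz
  -- The constant is `4` because the sum of the two coordinate differences is at most twice the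
  -- norm.
  have hlip : LipschitzOnWith 4 f A := by
    refine LipschitzOnWith.of_dist_le_mul fun z hz z' hz' => ?_
    rw [Real.dist_eq, dist_eq_norm]
    refine ((hf z hz).abs_sub_le (hf z' hz')).trans ?_
    have h1 := Complex.abs_re_le_norm (z - z')
    have h2 := Complex.abs_im_le_norm (z - z')
    rw [Complex.sub_re] at h1
    rw [Complex.sub_im] at h2
    simp only [NNReal.coe_ofNat]
    linarith
  obtain ⟨g, hg, hfg⟩ := hlip.extend_real
  refine ⟨g, hg, fun z c hc => ?_⟩
  have hz : z ∈ A := ⟨c, hc⟩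
  rw [← hfg hz]
  -- The estimate at a single point shows that the projected value is unique.
  have := (hf z hz).abs_sub_le hc
  simp only [sub_self, abs_zero, add_zero, mul_zero] at this
  exact sub_eq_zero.1 (abs_nonpos_iff.1 this)

/-- A subcell leaving the axis fits between the two squares: `|d| ≥ 1` gives the lower inequality
and `2 * |d| + 1 ≤ l.ratio m` the upper one. -/
lemma isProjection_of_digit (m : ℕ) {a d : ℤ} (hd0 : d ≠ 0) (hd : 2 * |d| + 1 ≤ l.ratio m)
    {x y : ℝ} (hxy : |x| + |y| ≤ 1) :
    l.IsProjection (2 * a / l.scale m + x / l.scale (m + 1)) ((2 * d + y) / l.scale (m + 1))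
      (2 * a / l.scale m) := by
  have hs : (0 : ℝ) < l.scale (m + 1) := by exact_mod_cast l.scale_pos (m + 1)
  have hm : (0 : ℝ) < l.scale m := by exact_mod_cast l.scale_pos m
  have hr : (0 : ℝ) < l.ratio m := by exact_mod_cast l.ratio_pos m
  have h1 : (1 : ℝ) ≤ |(d : ℝ)| := by exact_mod_cast Int.one_le_abs hd0
  have h2 : 2 * |(d : ℝ)| + 1 ≤ l.ratio m := by exact_mod_cast hd
  have h3 : |2 * (d : ℝ) + y| ≤ 2 * |(d : ℝ)| + |y| := by
    refine (abs_add_le _ _).trans_eq ?_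
    rw [abs_mul, abs_two]
  have h4 : 2 * |(d : ℝ)| - |y| ≤ |2 * (d : ℝ) + y| := by
    have := abs_sub_abs_le_abs_sub (2 * (d : ℝ)) (-y)
    rwa [abs_mul, abs_two, abs_neg, sub_neg_eq_add] at this
  refine Or.inr ⟨m, a, rfl, ?_, ?_⟩
  · rw [add_sub_cancel_left, abs_div, abs_div, abs_of_pos hs, ← sub_div]
    gcongr
    linarith
  · have h5 : 1 / (l.scale m : ℝ) = l.ratio m / l.scale (m + 1) := by
      rw [scale_succ]; push_cast; field_simp
    rw [add_sub_cancel_left, abs_div, abs_div, abs_of_pos hs, h5, ← sub_div]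
    gcongr
    linarith

/-! ### Coordinates in a cell -/

/-- In rotated coordinates the square is the unit ball of the `ℓ^1` norm. -/
lemma abs_re_add_abs_im_le {z : ℂ} (hz : z ∈ square) :
    |(z / corner 0).re| + |(z / corner 0).im| ≤ 1 := by
  have h : square ⊆ {z : ℂ | |(z / corner 0).re| + |(z / corner 0).im| ≤ 1} := by
    refine convexHull_min ?_ ?_
    · rintro _ ⟨j, rfl⟩
      rw [Set.mem_ofPred_eq, corner_eq, mul_div_cancel_right₀ _ (corner_ne_zero 0)]
      fin_cases j <;> simp [pow_succ]
    · intro x hx y hy a b ha hb hab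
      simp only [Set.mem_ofPred_eq] at hx hy ⊢
      have h1 : (a • x + b • y) / corner 0
          = ((a : ℝ) : ℂ) * (x / corner 0) + ((b : ℝ) : ℂ) * (y / corner 0) := by
        rw [Complex.real_smul, Complex.real_smul]; ring
      rw [h1, Complex.add_re, Complex.add_im, Complex.re_ofReal_mul, Complex.re_ofReal_mul,
        Complex.im_ofReal_mul, Complex.im_ofReal_mul]
      generalize x / corner 0 = x' at *
      generalize y / corner 0 = y' at *
      have h2 := abs_add_le (a * x'.re) (b * y'.re)
      have h3 := abs_add_le (a * x'.im) (b * y'.im)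
      rw [abs_mul, abs_mul, abs_of_nonneg ha, abs_of_nonneg hb] at h2 h3
      have h4 := mul_le_mul_of_nonneg_left hx ha
      have h5 := mul_le_mul_of_nonneg_left hy hb
      linarith
  exact h hz

/-- The coordinate of the plane centred at a cell and rotated by the direction of the first
corner. -/
noncomputable def cellCoord (n : ℕ) (w : Word l n) (z : ℂ) : ℂ :=
  (z - wordMap l n w 0) / corner 0

lemma dist_cellCoord (n : ℕ) (w : Word l n) (z z' : ℂ) :
    dist (l.cellCoord n w z) (l.cellCoord n w z') = dist z z' := by
  rw [cellCoord, cellCoord, dist_eq_norm, ← sub_div, norm_div, norm_corner, div_one,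
    sub_sub_sub_cancel_right, dist_eq_norm]

lemma cellCoord_wordMap (n : ℕ) (w : Word l n) (z : ℂ) :
    l.cellCoord n w (wordMap l n w z) = z / corner 0 / l.scale n := by
  rw [cellCoord, wordMap_sub, sub_zero, div_right_comm]

lemma norm_cellCoord_le {n : ℕ} {w : Word l n} {z : ℂ} (hz : z ∈ wordMap l n w '' square) :
    ‖l.cellCoord n w z‖ ≤ 1 / l.scale n := by
  obtain ⟨y, hy, rfl⟩ := hz
  rw [cellCoord_wordMap, norm_div, norm_div, norm_corner, div_one, Complex.norm_natCast]
  gcongr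
  exact norm_le_of_mem_square hy

/-- Each cell of level `n + k` lies in a cell of level `n`, and unless it is centred on one of the
axes of this cell, its projection to this axis is a single point. -/
lemma exists_ancestor (n k : ℕ) (v : Word l (n + k)) : ∃ (w : Word l n) (a b : ℤ),
    wordMap l (n + k) v '' square ⊆ wordMap l n w '' square ∧
    l.cellCoord n w (wordMap l (n + k) v 0) * l.scale (n + k) =
      2 * ((a : ℂ) + (b : ℂ) * Complex.I) ∧
    (b = 0 ∨ ∃ c, ∀ z ∈ wordMap l (n + k) v '' square,
      l.IsProjection (l.cellCoord n w z).re (l.cellCoord n w z).im c) ∧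
    (a = 0 ∨ ∃ c, ∀ z ∈ wordMap l (n + k) v '' square,
      l.IsProjection (l.cellCoord n w z).im (l.cellCoord n w z).re c) := by
  induction k with
  | zero => exact ⟨v, 0, 0, subset_rfl, by simp [cellCoord], Or.inl rfl, Or.inl rfl⟩
  | succ k ih =>
    obtain ⟨w, a, b, hsub, hab, hx, hy⟩ := ih fun k => v k.castSucc
    set v' : Word l (n + k) := fun k => v k.castSucc
    obtain ⟨c, d, hcd0, hc, hd, hcd⟩ :=
      exists_int_of_mem_digits (l.odd_ratio (n + k)) (v (Fin.last (n + k))).2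
    have hsub' : wordMap l (n + (k + 1)) v '' square ⊆ wordMap l (n + k) v' '' square := by
      rintro _ ⟨z, hz, rfl⟩
      exact ⟨_, contraction_mem_square l (n + k) (v (Fin.last (n + k))).2 hz, rfl⟩
    have hs0 := l.scale_cast_ne_zero (n + k)
    have hr0 := l.ratio_cast_ne_zero (n + k)
    have hcenter : l.cellCoord n w (wordMap l (n + (k + 1)) v 0) * l.scale (n + (k + 1)) =
        2 * (((l.ratio (n + k) * a + c : ℤ) : ℂ)
          + ((l.ratio (n + k) * b + d : ℤ) : ℂ) * Complex.I) := by
      have h1 : l.cellCoord n w (wordMap l (n + (k + 1)) v 0)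
          = l.cellCoord n w (wordMap l (n + k) v' 0)
            + (v (Fin.last (n + k)) : ℂ) / l.scale (n + k) / corner 0 := by
        rw [cellCoord, cellCoord, show wordMap l (n + (k + 1)) v 0 = wordMap l (n + k) v' 0
          + (v (Fin.last (n + k)) : ℂ) / l.scale (n + k) from l.wordMap_succ_zero (n + k) v]
        ring
      have h2 : (l.scale (n + (k + 1)) : ℂ) = l.scale (n + k) * l.ratio (n + k) := by
        exact_mod_cast l.scale_succ (n + k)
      have hq := corner_ne_zero 0
      calc _ = l.cellCoord n w (wordMap l (n + k) v' 0) * l.scale (n + k) * l.ratio (n + k)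
            + (v (Fin.last (n + k)) : ℂ) * l.ratio (n + k) / corner 0 := by
            rw [h1, h2]; field_simp
        _ = _ := by
            rw [hab, hcd, mul_div_cancel_right₀ _ hq]; push_cast; ring
    have hcoord : ∀ z ∈ square, ∃ x y : ℝ, |x| + |y| ≤ 1 ∧
        (l.cellCoord n w (wordMap l (n + (k + 1)) v z)).re =
          2 * a / l.scale (n + k) + (2 * c + x) / l.scale (n + k + 1) ∧
        (l.cellCoord n w (wordMap l (n + (k + 1)) v z)).im =
          2 * b / l.scale (n + k) + (2 * d + y) / l.scale (n + k + 1) := by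
      intro z hz
      refine ⟨_, _, abs_re_add_abs_im_le hz, ?_⟩
      have h1 : l.cellCoord n w (wordMap l (n + (k + 1)) v z)
          = (((2 * a / l.scale (n + k) + (2 * c + (z / corner 0).re) / l.scale (n + k + 1) : ℝ)) : ℂ)
          + (((2 * b / l.scale (n + k) + (2 * d + (z / corner 0).im) / l.scale (n + k + 1) : ℝ)) : ℂ)
            * Complex.I := by
        have h2 : l.cellCoord n w (wordMap l (n + (k + 1)) v z)
            = l.cellCoord n w (wordMap l (n + (k + 1)) v 0)
              + z / corner 0 / l.scale (n + k + 1) := by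
          rw [cellCoord, cellCoord, wordMap_eq l (n + (k + 1)) v z]
          rw [show l.scale (n + (k + 1)) = l.scale (n + k + 1) from rfl]
          ring
        have h3 := (eq_div_iff (l.scale_cast_ne_zero (n + (k + 1)))).2 hcenter
        rw [h2, h3, show l.scale (n + (k + 1)) = l.scale (n + k + 1) from rfl]
        have h4 := Complex.re_add_im (z / corner 0)
        have h5 : (l.scale (n + k + 1) : ℂ) = l.scale (n + k) * l.ratio (n + k) := by
          exact_mod_cast l.scale_succ (n + k)
        nth_rewrite 1 [← h4]
        rw [h5]
        push_cast
        rw [h5]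
        field_simp
        ring
      rw [h1]
      constructor <;> simp
    refine ⟨w, l.ratio (n + k) * a + c, l.ratio (n + k) * b + d, hsub'.trans hsub, hcenter, ?_, ?_⟩
    -- A parent on the axis either keeps its child there (`d = 0`) or sends it off perpendicularly,
    -- with `c = 0`, and the foot is the parent's centre. Once the projection is a point, all
    -- descendants inherit it.
    · rcases hx with rfl | ⟨e, he⟩
      · by_cases hd0 : d = 0
        · exact Or.inl (by simp [hd0])
        · have hc0 : c = 0 := hcd0.resolve_right hd0
          refine Or.inr ⟨2 * a / l.scale (n + k), ?_⟩
          rintro _ ⟨z, hz, rfl⟩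
          obtain ⟨x, y, hxy, h1, h2⟩ := hcoord z hz
          have := l.isProjection_of_digit (n + k) (a := a) hd0 hd hxy
          rw [h1, h2, hc0]
          simpa using this
      · exact Or.inr ⟨e, fun z hz => he z (hsub' hz)⟩
    · rcases hy with rfl | ⟨e, he⟩
      · by_cases hc0 : c = 0
        · exact Or.inl (by simp [hc0])
        · have hd0 : d = 0 := hcd0.resolve_left hc0
          refine Or.inr ⟨2 * b / l.scale (n + k), ?_⟩
          rintro _ ⟨z, hz, rfl⟩
          obtain ⟨x, y, hxy, h1, h2⟩ := hcoord z hz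
          have := l.isProjection_of_digit (n + k) (a := b) hc0 hc ((add_comm _ _).trans_le hxy)
          rw [h1, h2, hd0]
          simpa using this
      · exact Or.inr ⟨e, fun z hz => he z (hsub' hz)⟩

/-- Distinct cells of the same level meet at most in common corners. -/
lemma exists_corner_of_mem_inter {n : ℕ} {w w' : Word l n} (hne : w ≠ w') {z : ℂ}
    (hz : z ∈ wordMap l n w '' square) (hz' : z ∈ wordMap l n w' '' square) :
    ∃ j, z = wordMap l n w (corner j) := by
  obtain ⟨y, hy, rfl⟩ := hz
  obtain ⟨y', hy', hyy⟩ := hz'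
  obtain ⟨a, b, hab⟩ := l.exists_int_center n w
  obtain ⟨a', b', hab'⟩ := l.exists_int_center n w'
  have h0 := l.scale_cast_ne_zero n
  have hq := corner_ne_zero 0
  have h1 : y / corner 0 - y' / corner 0 =
      2 * (((a' - a : ℤ) : ℂ) + ((b' - b : ℤ) : ℂ) * Complex.I) := by
    have h2 := congrArg (fun z => z * (l.scale n : ℂ)) hyy
    rw [wordMap_eq l n w y, wordMap_eq l n w' y', add_mul, add_mul, hab, hab',
      div_mul_cancel₀ _ h0, div_mul_cancel₀ _ h0] at h2
    rw [← sub_div, div_eq_iff hq]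
    push_cast
    linear_combination -h2
  have hne' : ¬ (a' - a = 0 ∧ b' - b = 0) := by
    rintro ⟨h2, h3⟩
    obtain rfl : a' = a := by linarith
    obtain rfl : b' = b := by linarith
    exact hne (l.wordMap_zero_injective n (mul_right_cancel₀ h0 (hab.trans hab'.symm)))
  have hx := abs_re_add_abs_im_le hy
  have hx' := abs_re_add_abs_im_le hy'
  have hre := congrArg Complex.re h1
  have him := congrArg Complex.im h1
  rw [Complex.sub_re] at hre
  rw [Complex.sub_im] at him
  generalize a' - a = α at *
  generalize b' - b = β at *
  simp at hre him
  have hy0 : y = y / corner 0 * corner 0 := (div_mul_cancel₀ _ hq).symm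
  suffices h : ∃ j : Fin 4, y / corner 0 = Complex.I ^ (j : ℕ) by
    obtain ⟨j, hj⟩ := h
    exact ⟨j, by rw [hy0, hj, ← corner_eq]⟩
  rw [← Complex.re_add_im (y / corner 0)]
  generalize (y / corner 0).re = s at *
  generalize (y / corner 0).im = t at *
  generalize (y' / corner 0).re = s' at *
  generalize (y' / corner 0).im = t' at *
  -- Two unit `ℓ^1` balls meet and their centres differ by `2 * (α, β)`: the cells must be lattice
  -- neighbours, touching in a single point.
  have hα : |(α : ℝ)| + |(β : ℝ)| ≤ 1 := by
    have h2 := abs_sub s s'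
    have h3 := abs_sub t t'
    rw [hre, abs_mul, abs_two] at h2
    rw [him, abs_mul, abs_two] at h3
    linarith
  have hα' : |α| + |β| ≤ 1 := by exact_mod_cast hα
  have hα1 := abs_le.1 (show |α| ≤ 1 by linarith [abs_nonneg β])
  have hβ1 := abs_le.1 (show |β| ≤ 1 by linarith [abs_nonneg α])
  have e1 := le_abs_self s
  have e2 := neg_abs_le s
  have e3 := le_abs_self t
  have e4 := neg_abs_le t
  have e5 := le_abs_self s'
  have e6 := neg_abs_le s'
  have e7 := le_abs_self t'
  have e8 := neg_abs_le t'
  obtain ⟨hα1, hα2⟩ := hα1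
  obtain ⟨hβ1, hβ2⟩ := hβ1
  interval_cases α <;> interval_cases β
  all_goals first
    | (exfalso; revert hα'; decide)
    | (exfalso; revert hne'; decide)
    | push_cast at hre him
  · obtain rfl : s = -1 := by linarith
    obtain rfl : t = 0 := by linarith
    exact ⟨2, by simp⟩
  · obtain rfl : s = 0 := by linarith
    obtain rfl : t = -1 := by linarith
    exact ⟨3, by simp [pow_succ]⟩
  · obtain rfl : s = 0 := by linarith
    obtain rfl : t = 1 := by linarith
    exact ⟨1, by simp⟩
  · obtain rfl : s = 1 := by linarith
    obtain rfl : t = 0 := by linarith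
    exact ⟨0, by simp⟩

/-! ### Interpolation -/

lemma abs_max_zero_sub_le (a b : ℝ) : |max 0 a - max 0 b| ≤ |a - b| := by
  have := abs_max_sub_max_le_max 0 a 0 b
  simpa using this

/-- Interchange of the coordinates of the plane. -/
def swapCoord (z : ℂ) : ℂ := ⟨z.im, z.re⟩

lemma dist_swapCoord (z z' : ℂ) : dist (swapCoord z) (swapCoord z') = dist z z' := by
  simp [Complex.dist_eq_re_im, swapCoord, add_comm]

variable (l : VicsekScale)

/-- The function on a cell of level `n` that interpolates a function `U` between its values at the
centre and the corners, is linear on the segments joining these points and constant on the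
branches of the Vicsek set that leave these segments, provided that `h` is a projection to the
first axis. -/
noncomputable def cellInterpolation (h U : ℂ → ℝ) (n : ℕ) (w : Word l n) (z : ℂ) : ℝ :=
  U (wordMap l n w 0) + l.scale n *
    ((U (wordMap l n w (corner 0)) - U (wordMap l n w 0)) * max 0 (h (l.cellCoord n w z))
    + (U (wordMap l n w (corner 2)) - U (wordMap l n w 0)) * max 0 (-h (l.cellCoord n w z))
    + (U (wordMap l n w (corner 1)) - U (wordMap l n w 0)) *
        max 0 (h (swapCoord (l.cellCoord n w z)))
    + (U (wordMap l n w (corner 3)) - U (wordMap l n w 0)) *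
        max 0 (-h (swapCoord (l.cellCoord n w z))))

variable {h : ℂ → ℝ}

lemma continuous_cellInterpolation (hlip : LipschitzWith 4 h)
    (U : ℂ → ℝ)
    (n : ℕ) (w : Word l n) :
    Continuous (l.cellInterpolation h U n w) := by
  have h1 : Continuous (l.cellCoord n w) :=
    (continuous_id.sub continuous_const).div_const _
  have h2 : Continuous swapCoord := (Isometry.of_dist_eq dist_swapCoord).continuous
  have h3 := hlip.continuous
  unfold cellInterpolation
  fun_prop

/-- Kept in terms of `h`, since it serves twice: for the Lipschitz bound, and to show that the
function is constant where both projections are. -/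
lemma abs_cellInterpolation_sub_le (U : ℂ → ℝ)
    {n : ℕ} {w : Word l n} {M : ℝ}
    (hM : ∀ j, |U (wordMap l n w (corner j)) - U (wordMap l n w 0)| ≤ M) (z z' : ℂ) :
    |l.cellInterpolation h U n w z - l.cellInterpolation h U n w z'| ≤ l.scale n * (2 * M *
      (|h (l.cellCoord n w z) - h (l.cellCoord n w z')| +
        |h (swapCoord (l.cellCoord n w z)) - h (swapCoord (l.cellCoord n w z'))|)) := by
  simp only [cellInterpolation]
  generalize l.cellCoord n w z = ζ
  generalize l.cellCoord n w z' = ζ'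
  have hM0 : 0 ≤ M := (abs_nonneg _).trans (hM 0)
  have hterm : ∀ j a b, |(U (wordMap l n w (corner j)) - U (wordMap l n w 0)) * max 0 a -
      (U (wordMap l n w (corner j)) - U (wordMap l n w 0)) * max 0 b| ≤ M * |a - b| := by
    intro j a b
    rw [← mul_sub, abs_mul]
    exact mul_le_mul (hM j) (abs_max_zero_sub_le a b) (abs_nonneg _) hM0
  rw [add_sub_add_left_eq_sub, ← mul_sub, abs_mul, Nat.abs_cast]
  refine mul_le_mul_of_nonneg_left ?_ (by positivity)
  have h0 := hterm 0 (h ζ) (h ζ')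
  have h2 := hterm 2 (-h ζ) (-h ζ')
  have h1 := hterm 1 (h (swapCoord ζ)) (h (swapCoord ζ'))
  have h3 := hterm 3 (-h (swapCoord ζ)) (-h (swapCoord ζ'))
  rw [neg_sub_neg, abs_sub_comm (h ζ')] at h2
  rw [neg_sub_neg, abs_sub_comm (h (swapCoord ζ'))] at h3
  rw [abs_le] at h0 h1 h2 h3 ⊢
  constructor <;> linarith

lemma abs_cellInterpolation_sub_le_dist (hlip : LipschitzWith 4 h)
    (U : ℂ → ℝ)
    {n : ℕ} {w : Word l n} {M : ℝ}
    (hM : ∀ j, |U (wordMap l n w (corner j)) - U (wordMap l n w 0)| ≤ M) (z z' : ℂ) :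
    |l.cellInterpolation h U n w z - l.cellInterpolation h U n w z'| ≤
      l.scale n * (16 * M * dist z z') := by
  have hM0 : 0 ≤ M := (abs_nonneg _).trans (hM 0)
  refine (l.abs_cellInterpolation_sub_le U hM z z').trans ?_
  have h1 := hlip.dist_le_mul (l.cellCoord n w z) (l.cellCoord n w z')
  have h2 := hlip.dist_le_mul (swapCoord (l.cellCoord n w z)) (swapCoord (l.cellCoord n w z'))
  rw [dist_swapCoord] at h2
  rw [dist_cellCoord, Real.dist_eq] at h1 h2
  simp only [NNReal.coe_ofNat] at h1 h2
  refine mul_le_mul_of_nonneg_left ?_ (by positivity)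
  calc _ ≤ 2 * M * (4 * dist z z' + 4 * dist z z') := by gcongr
    _ = _ := by ring

lemma projection_axis (hproj : ∀ z c, l.IsProjection z.re z.im c → h z = c)
    (x : ℝ) : h x = x := hproj _ _ (Or.inl (by simp))

/-- The corners on the other axis lie at the tip of the branch of level `n` with foot `0`, where the
outer inequality is an equality. -/
lemma projection_swap_axis (hproj : ∀ z c, l.IsProjection z.re z.im c → h z = c)
    (n : ℕ) {t : ℝ} (ht : |t| = 1 / l.scale n) :
    h (swapCoord t) = 0 := by
  refine hproj _ _ (Or.inr ⟨n, 0, by simp, ?_, ?_⟩)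
  · simpa [swapCoord, ht] using l.one_div_scale_anti n.le_succ
  · simp [swapCoord, ht]

lemma cellInterpolation_center (hproj : ∀ z c, l.IsProjection z.re z.im c → h z = c)
    (U : ℂ → ℝ)
    (n : ℕ) (w : Word l n) :
    l.cellInterpolation h U n w (wordMap l n w 0) = U (wordMap l n w 0) := by
  have h0 : h 0 = 0 := by simpa using l.projection_axis hproj 0
  have h1 : swapCoord 0 = 0 := rfl
  simp [cellInterpolation, cellCoord_wordMap, h0, h1]

lemma cellInterpolation_corner (hproj : ∀ z c, l.IsProjection z.re z.im c → h z = c)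
    (U : ℂ → ℝ)
    (n : ℕ) (w : Word l n) (j : Fin 4) :
    l.cellInterpolation h U n w (wordMap l n w (corner j)) = U (wordMap l n w (corner j)) := by
  have hs : (0 : ℝ) < l.scale n := by exact_mod_cast l.scale_pos n
  have hcoord : ∀ j, l.cellCoord n w (wordMap l n w (corner j))
      = Complex.I ^ (j : ℕ) / l.scale n := fun j => by
    rw [cellCoord_wordMap, corner_eq, mul_div_cancel_right₀ _ (corner_ne_zero 0)]
  have hpos : |1 / (l.scale n : ℝ)| = 1 / l.scale n := abs_of_pos (by positivity)
  have hneg : |-(1 / (l.scale n : ℝ))| = 1 / l.scale n := by rw [abs_neg, hpos]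
  have e1 := l.projection_axis hproj (1 / l.scale n)
  have e2 := l.projection_axis hproj (-(1 / l.scale n))
  have e3 := l.projection_swap_axis hproj n hpos
  have e4 := l.projection_swap_axis hproj n hneg
  have hswap : ∀ t : ℝ, swapCoord t = t * Complex.I := fun t => by
    apply Complex.ext <;> simp [swapCoord]
  have hswap' : ∀ t : ℝ, swapCoord (t * Complex.I) = t := fun t => by
    rw [← hswap]; rfl
  rw [hswap] at e3 e4
  have hm : max 0 (1 / (l.scale n : ℝ)) = 1 / l.scale n := max_eq_right (by positivity)
  have hm' : max 0 (-(1 / (l.scale n : ℝ))) = 0 := max_eq_left (by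
    rw [neg_nonpos]; positivity)
  have c0 : l.cellCoord n w (wordMap l n w (corner 0)) = ((1 / l.scale n : ℝ) : ℂ) := by
    rw [hcoord]; simp
  have c1 : l.cellCoord n w (wordMap l n w (corner 1))
      = ((1 / l.scale n : ℝ) : ℂ) * Complex.I := by
    rw [hcoord]; simp; ring
  have c2 : l.cellCoord n w (wordMap l n w (corner 2)) = ((-(1 / l.scale n) : ℝ) : ℂ) := by
    rw [hcoord]; simp; ring
  have c3 : l.cellCoord n w (wordMap l n w (corner 3))
      = ((-(1 / l.scale n) : ℝ) : ℂ) * Complex.I := by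
    rw [hcoord]; simp [pow_succ]; ring
  have hcases : ∀ P : Fin 4 → Prop, P 0 → P 1 → P 2 → P 3 → ∀ j, P j := fun P h0 h1 h2 h3 j => by
    fin_cases j <;> assumption
  refine hcases (fun j => l.cellInterpolation h U n w (wordMap l n w (corner j))
    = U (wordMap l n w (corner j))) ?_ ?_ ?_ ?_ j
  · simp only [cellInterpolation, c0, e1, hswap, e3, hm, hm', neg_zero, max_self]
    field_simp
    ring
  · simp only [cellInterpolation, c1, e1, hswap', e3, hm, hm', neg_zero, max_self]
    field_simp
    ring
  · simp only [cellInterpolation, c2, e2, hswap, e4, hm, hm', neg_neg, neg_zero, max_self]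
    field_simp
    ring
  · simp only [cellInterpolation, c3, e2, hswap', e4, hm, hm', neg_neg, neg_zero, max_self]
    field_simp
    ring

/-- The interpolations in the cells are the restrictions of one continuous function. -/
lemma exists_interpolation (hlip : LipschitzWith 4 h)
    (hproj : ∀ z c, l.IsProjection z.re z.im c → h z = c)
    (U : ℂ → ℝ)
    (n : ℕ) : ∃ f : C(carrier l, ℝ), ∀ (w : Word l n) (x : carrier l),
    (x : ℂ) ∈ wordMap l n w '' square → f x = l.cellInterpolation h U n w x := by
  choose w hw using fun x : carrier l => Set.mem_iUnion.1 (Set.mem_iInter.1 x.2 n)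
  set f : carrier l → ℝ := fun x => l.cellInterpolation h U n (w x) x
  have hf : ∀ (v : Word l n) (x : carrier l), (x : ℂ) ∈ wordMap l n v '' square →
      f x = l.cellInterpolation h U n v x := by
    intro v x hx
    -- The choice of the cell is immaterial: distinct cells share only corners, where both
    -- interpolations equal `U`.
    by_cases hv : w x = v
    · rw [← hv]
    · obtain ⟨i, hi⟩ := l.exists_corner_of_mem_inter hv (hw x) hx
      obtain ⟨j, hj⟩ := l.exists_corner_of_mem_inter (Ne.symm hv) hx (hw x)
      have h1 := l.cellInterpolation_corner hproj U n (w x) i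
      have h2 := l.cellInterpolation_corner hproj U n v j
      rw [← hi] at h1
      rw [← hj] at h2
      exact h1.trans h2.symm
  have hcont : Continuous f := by
    refine (locallyFinite_of_finite fun v : Word l n =>
      {x : carrier l | (x : ℂ) ∈ wordMap l n v '' square}).continuous ?_ ?_ ?_
    · exact Set.eq_univ_of_forall fun x => Set.mem_iUnion.2 ⟨w x, hw x⟩
    · exact fun v => (isClosed_cell l n v).preimage continuous_subtype_val
    · exact fun v => ((l.continuous_cellInterpolation hlip U n v).comp
        continuous_subtype_val).continuousOn.congr fun x hx => hf v x hx
  exact ⟨⟨f, hcont⟩, hf⟩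

/-! ### Finite energy of interpolations and density -/

/-- The cells that are centred on an axis of an ancestor of level `n`. -/
lemma exists_finset_axis (n k : ℕ) : ∃ S : Finset (Word l (n + k)),
    S.card ≤ 6 * Fintype.card (Word l n) * l.scale (n + k) ∧
    ∀ v, ∃ w : Word l n, wordMap l (n + k) v '' square ⊆ wordMap l n w '' square ∧
      (v ∉ S → (∃ c, ∀ z ∈ wordMap l (n + k) v '' square,
        l.IsProjection (l.cellCoord n w z).re (l.cellCoord n w z).im c) ∧
      ∃ c, ∀ z ∈ wordMap l (n + k) v '' square,
        l.IsProjection (l.cellCoord n w z).im (l.cellCoord n w z).re c) := by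
  classical
  choose w a b hsub hab hx hy using l.exists_ancestor n k
  set N : ℤ := ((l.scale (n + k) : ℕ) : ℤ)
  set R : Finset (Word l n × Bool × ℤ) := Finset.univ ×ˢ Finset.univ ×ˢ Finset.Icc (-N) N
  -- A cell on an axis is determined by its ancestor, the axis and one integer coordinate; the
  -- Boolean is `true` when `a v = 0`, which also covers the centre.
  set φ : Word l (n + k) → Word l n × Bool × ℤ := fun v =>
    if a v = 0 then (w v, true, b v) else (w v, false, a v)
  set S : Finset (Word l (n + k)) := Finset.univ.filter fun v => a v = 0 ∨ b v = 0
  have hbound : ∀ v, |a v| ≤ N ∧ |b v| ≤ N := by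
    intro v
    have h1 := congrArg norm (hab v)
    rw [norm_mul, norm_mul, Complex.norm_natCast, Complex.norm_two] at h1
    have h2 := l.norm_cellCoord_le (hsub v ⟨0, zero_mem_square, rfl⟩)
    have h3 : 1 / (l.scale n : ℝ) ≤ 1 := by
      have := l.one_div_scale_anti (Nat.zero_le n)
      simpa [scale] using this
    have h4 : ‖((a v : ℂ) + (b v : ℂ) * Complex.I)‖ ≤ (N : ℝ) := by
      have h5 : ‖l.cellCoord n (w v) (wordMap l (n + k) v 0)‖ * (l.scale (n + k) : ℝ)
          ≤ 1 * (l.scale (n + k) : ℝ) := by gcongr; exact h2.trans h3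
      have h6 : (N : ℝ) = l.scale (n + k) := by simp [N]
      rw [h6]
      linarith [norm_nonneg ((a v : ℂ) + (b v : ℂ) * Complex.I)]
    have h5 := (Complex.abs_re_le_norm _).trans h4
    have h6 := (Complex.abs_im_le_norm _).trans h4
    simp at h5 h6
    exact ⟨by exact_mod_cast h5, by exact_mod_cast h6⟩
  have hφ : Set.InjOn φ S := by
    have hinj : ∀ v v', w v = w v' → a v = a v' → b v = b v' → v = v' := by
      intro v v' h1 h2 h3
      have h4 := hab v
      rw [h2, h3, ← hab v'] at h4
      have h5 := mul_right_cancel₀ (l.scale_cast_ne_zero (n + k)) h4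
      rw [cellCoord, cellCoord, h1] at h5
      exact l.wordMap_zero_injective (n + k)
        (sub_left_injective ((div_left_inj' (corner_ne_zero 0)).1 h5))
    intro v hv v' hv' hvv
    have hv1 : a v = 0 ∨ b v = 0 := by simpa [S] using hv
    have hv2 : a v' = 0 ∨ b v' = 0 := by simpa [S] using hv'
    by_cases h1 : a v = 0 <;> by_cases h2 : a v' = 0 <;>
      simp only [φ, h1, h2, if_true, if_false, Prod.mk.injEq, reduceCtorEq, false_and, and_false,
        true_and] at hvv
    · exact hinj v v' hvv.1 (h1.trans h2.symm) hvv.2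
    · exact hinj v v' hvv.1 hvv.2 ((hv1.resolve_left h1).trans (hv2.resolve_left h2).symm)
  refine ⟨S, ?_, fun v => ⟨w v, hsub v, fun hv => ?_⟩⟩
  · have h1 : S.card ≤ R.card := Finset.card_le_card_of_injOn φ (fun v _ => by
      simp only [φ, R, Finset.coe_product, Set.mem_prod, Finset.coe_univ, Set.mem_univ, true_and,
        Finset.coe_Icc, Set.mem_Icc]
      split_ifs
      · exact abs_le.1 (hbound v).2
      · exact abs_le.1 (hbound v).1) hφ
    have h2 : R.card = Fintype.card (Word l n) * (2 * (2 * l.scale (n + k) + 1)) := by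
      simp only [R, Finset.card_product, Finset.card_univ, Fintype.card_bool, Int.card_Icc]
      congr 2
      simp only [N]
      omega
    rw [h2] at h1
    have h3 := l.scale_pos (n + k)
    -- `2 * (2 * N + 1) ≤ 6 * N` because `N ≥ 1`.
    calc S.card ≤ _ := h1
      _ ≤ Fintype.card (Word l n) * (6 * l.scale (n + k)) := Nat.mul_le_mul_left _ (by omega)
      _ = _ := by ring
  · have hv' : ¬ (a v = 0 ∨ b v = 0) := by simpa [S] using hv
    rw [not_or] at hv'
    exact ⟨(hx v).resolve_left hv'.2, (hy v).resolve_left hv'.1⟩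

/-- Cells off the axes contribute nothing. The others number `O(l.scale (n + k))`, and each star is
at most `4 * (B / l.scale (n + k)) ^ p`; the weight `(l.scale (n + k)) ^ (p - 1)` cancels all powers
of the scale. -/
lemma mem_energyDomain_of_interpolation (hlip : LipschitzWith 4 h)
    (hproj : ∀ z c, l.IsProjection z.re z.im c → h z = c)
    (U : ℂ → ℝ)
    {p : ℝ} [hp : Fact (1 < p)] {n : ℕ} {M : ℝ}
    (hM : ∀ (w : Word l n) j, |U (wordMap l n w (corner j)) - U (wordMap l n w 0)| ≤ M)
    {f : C(carrier l, ℝ)} (hf : ∀ (w : Word l n) (x : carrier l),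
      (x : ℂ) ∈ wordMap l n w '' square → f x = l.cellInterpolation h U n w x) :
    f ∈ energyDomain l p := by
  have hp0 : 0 < p := by linarith [hp.out]
  set B : ℝ := l.scale n * (16 * M)
  have hB : 0 ≤ B := by
    have : 0 ≤ M := (abs_nonneg _).trans (hM (fun k => ⟨0, zero_mem_digits _⟩) 0)
    positivity
  have hlevel : ∀ k, discreteEnergy l p (n + k) f ≤
      6 * Fintype.card (Word l n) * (4 * B ^ p) := by
    intro k
    obtain ⟨S, hS, hanc⟩ := l.exists_finset_axis n k
    have hs : (0 : ℝ) < l.scale (n + k) := by exact_mod_cast l.scale_pos (n + k)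
    have hpt : ∀ (v : Word l (n + k)) (w : Word l n),
        wordMap l (n + k) v '' square ⊆ wordMap l n w '' square → ∀ z ∈ baseVertices,
        zeroExtend f (wordMap l (n + k) v z) =
          l.cellInterpolation h U n w (wordMap l (n + k) v z) := by
      intro v w hvw z hz
      have hmem : wordMap l (n + k) v z ∈ carrier l := planeVertices_subset l _ _
        (Finset.mem_image.2 ⟨(v, z), by simpa using hz, rfl⟩)
      rw [zeroExtend_of_mem f hmem]
      exact hf w ⟨_, hmem⟩ (hvw ⟨z, baseVertices_subset z hz, rfl⟩)
    have h0mem : (0 : ℂ) ∈ baseVertices := by simp [baseVertices]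
    have hjmem : ∀ j, corner j ∈ baseVertices := fun j => by simp [baseVertices]
    have hstar : ∀ v : Word l (n + k),
        starEnergy p (fun z => zeroExtend f (wordMap l (n + k) v z)) ≤
          4 * (B ^ p / (l.scale (n + k) : ℝ) ^ p) := by
      intro v
      obtain ⟨w, hvw, -⟩ := hanc v
      have hterm : ∀ j : Fin 4, |zeroExtend f (wordMap l (n + k) v 0) -
          zeroExtend f (wordMap l (n + k) v (corner j))| ^ p ≤
            B ^ p / (l.scale (n + k) : ℝ) ^ p := by
        intro j
        rw [hpt v w hvw 0 h0mem, hpt v w hvw _ (hjmem j), ← Real.div_rpow hB hs.le]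
        refine Real.rpow_le_rpow (abs_nonneg _) ?_ hp0.le
        refine (l.abs_cellInterpolation_sub_le_dist hlip U (hM w) _ _).trans_eq ?_
        rw [dist_wordMap_corner, ← mul_assoc, div_eq_mul_inv]
      refine (Finset.sum_le_sum fun j _ => hterm j).trans_eq ?_
      simp
    have hstar0 : ∀ v ∉ S, starEnergy p (fun z => zeroExtend f (wordMap l (n + k) v z)) = 0 := by
      intro v hv
      obtain ⟨w, hvw, hw⟩ := hanc v
      obtain ⟨⟨c, hc⟩, ⟨d, hd⟩⟩ := hw hv
      refine Finset.sum_eq_zero fun j _ => ?_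
      have h0 : wordMap l (n + k) v 0 ∈ wordMap l (n + k) v '' square := ⟨0, zero_mem_square, rfl⟩
      have hj : wordMap l (n + k) v (corner j) ∈ wordMap l (n + k) v '' square :=
        ⟨_, corner_mem_square j, rfl⟩
      have h1 := l.abs_cellInterpolation_sub_le (h := h) U (hM w) (wordMap l (n + k) v 0)
        (wordMap l (n + k) v (corner j))
      have hd' : ∀ z ∈ wordMap l (n + k) v '' square, h (swapCoord (l.cellCoord n w z)) = d :=
        fun z hz => hproj _ _ (hd z hz)
      rw [hproj _ _ (hc _ h0), hproj _ _ (hc _ hj), hd' _ h0, hd' _ hj] at h1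
      simp only [sub_self, abs_zero, add_zero, mul_zero] at h1
      beta_reduce
      rw [hpt v w hvw 0 h0mem, hpt v w hvw _ (hjmem j), le_antisymm h1 (abs_nonneg _),
        Real.zero_rpow hp0.ne']
    have hsum : ∑ v : Word l (n + k), starEnergy p (fun z => zeroExtend f (wordMap l (n + k) v z))
        ≤ S.card * (4 * (B ^ p / (l.scale (n + k) : ℝ) ^ p)) := by
      rw [← Finset.sum_subset (Finset.subset_univ S) fun v _ hv => hstar0 v hv, ← nsmul_eq_mul]
      exact Finset.sum_le_card_nsmul _ _ _ fun v _ => hstar v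
    rw [discreteEnergy_eq]
    have hS' : (S.card : ℝ) ≤ 6 * Fintype.card (Word l n) * l.scale (n + k) := by
      exact_mod_cast hS
    calc _ ≤ (l.scale (n + k) : ℝ) ^ (p - 1) * (6 * Fintype.card (Word l n) * l.scale (n + k) *
          (4 * (B ^ p / (l.scale (n + k) : ℝ) ^ p))) := by
          refine mul_le_mul_of_nonneg_left (hsum.trans ?_) (by positivity)
          gcongr
      _ = _ := by
          rw [Real.rpow_sub_one hs.ne']
          have : (l.scale (n + k) : ℝ) ^ p ≠ 0 := (Real.rpow_pos_of_pos hs _).ne'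
          field_simp
  refine (energy_le_of_forall (M := 6 * Fintype.card (Word l n) * (4 * B ^ p)) fun m => ?_).1
  -- Level `m` is dominated by level `n + m`, so levels below `n` need no separate treatment.
  exact (monotone_discreteEnergy hp.out f (Nat.le_add_left m n)).trans (hlevel m)

theorem dense_energyDomain (p : ℝ) [hp : Fact (1 < p)] :
    Dense (energyDomain l p : Set C(carrier l, ℝ)) := by
  obtain ⟨h, hlip, hproj⟩ := l.exists_lipschitz_projection
  intro u
  refine Metric.mem_closure_iff.2 fun ε hε => ?_
  -- Within a cell `u` differs from its central value by at most one unit `ε / 18`, and the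
  -- interpolation by at most `16` units; the total is `17 / 18 * ε`.
  obtain ⟨δ, hδ, hu⟩ := Metric.uniformContinuous_iff.1
    (CompactSpace.uniformContinuous_of_continuous u.continuous) (ε / 18) (by positivity)
  obtain ⟨n, hn⟩ := exists_pow_lt_of_lt_one (show 0 < δ / 2 by positivity)
    (by norm_num : (1 / 3 : ℝ) < 1)
  have hcell : ∀ (w : Word l n) (x y : carrier l), (x : ℂ) ∈ wordMap l n w '' square →
      (y : ℂ) ∈ wordMap l n w '' square → |u x - u y| ≤ ε / 18 := by
    intro w x y hx hy
    refine (hu ?_).le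
    refine lt_of_le_of_lt (dist_le_of_mem_cell l hx hy) ?_
    rw [one_div, inv_pow] at hn
    rw [div_eq_mul_inv]
    linarith
  have h0 : ∀ w : Word l n, wordMap l n w 0 ∈ wordMap l n w '' square := fun w =>
    ⟨0, zero_mem_square, rfl⟩
  have hM : ∀ (w : Word l n) j, |zeroExtend u (wordMap l n w (corner j)) -
      zeroExtend u (wordMap l n w 0)| ≤ ε / 18 := by
    intro w j
    rw [zeroExtend_of_mem u (l.wordMap_zero_mem n w),
      zeroExtend_of_mem u (l.wordMap_corner_mem n w j)]
    exact hcell w _ _ ⟨_, corner_mem_square j, rfl⟩ (h0 w)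
  obtain ⟨f, hf⟩ := l.exists_interpolation hlip hproj (zeroExtend u) n
  refine ⟨f, l.mem_energyDomain_of_interpolation hlip hproj (zeroExtend u) hM hf, ?_⟩
  refine (ContinuousMap.dist_le (by positivity : 0 ≤ 17 / 18 * ε)).2 (fun x => ?_) |>.trans_lt
    (by linarith)
  obtain ⟨w, hw⟩ := Set.mem_iUnion.1 (Set.mem_iInter.1 x.2 n)
  have h1 := hcell w x ⟨_, l.wordMap_zero_mem n w⟩ hw (h0 w)
  have h2 : |f x - u ⟨_, l.wordMap_zero_mem n w⟩| ≤ 16 * (ε / 18) := by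
    have h3 := l.abs_cellInterpolation_sub_le_dist hlip (zeroExtend u) (hM w) x (wordMap l n w 0)
    rw [l.cellInterpolation_center hproj, zeroExtend_of_mem u (l.wordMap_zero_mem n w),
      ← hf w x hw] at h3
    refine h3.trans ?_
    have h4 := l.norm_cellCoord_le hw
    rw [cellCoord, norm_div, norm_corner, div_one, ← dist_eq_norm] at h4
    have hs : (0 : ℝ) < l.scale n := by exact_mod_cast l.scale_pos n
    calc _ ≤ l.scale n * (16 * (ε / 18) * (1 / l.scale n)) := by gcongr
      _ = _ := by field_simp
  rw [Real.dist_eq]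
  have h3 := abs_sub_le (u x) (u ⟨_, l.wordMap_zero_mem n w⟩) (f x)
  rw [abs_sub_comm (u ⟨_, l.wordMap_zero_mem n w⟩)] at h3
  linarith

end VicsekScale

theorem theorem1p1 (l : VicsekScale) (p : ℝ) [Fact (1 < p)] :
    -- the discrete energies increase with the level
    (∀ u : C(l.carrier, ℝ), Monotone fun n : ℕ => l.discreteEnergy p n u) ∧
    -- the `p`-th root of the `p`-energy is a seminorm on its domain
    (∃ s : Seminorm ℝ (l.energyDomain p),
      ∀ u : l.energyDomain p, s u = l.energy p u ^ (1 / p)) ∧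
    -- uniformly convex separable reflexive Banach space
    CompleteSpace (l.Sobolev p) ∧
    UniformConvexSpace (l.Sobolev p) ∧
    TopologicalSpace.SeparableSpace (l.Sobolev p) ∧
    Function.Surjective (NormedSpace.inclusionInDoubleDual ℝ (l.Sobolev p)) ∧
    -- algebra
    (∀ u ∈ l.energyDomain p, ∀ v ∈ l.energyDomain p,
      u * v ∈ l.energyDomain p ∧
      l.energy p (u * v) ≤
        2 ^ (p - 1) * (‖u‖ ^ p * l.energy p v + ‖v‖ ^ p * l.energy p u)) ∧
    -- regularity
    Dense (l.energyDomain p : Set C(l.carrier, ℝ)) ∧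
    -- Lipschitz contractivity
    (∀ u ∈ l.energyDomain p, ∀ (φ : ℝ → ℝ) (hφ : LipschitzWith 1 φ),
      (ContinuousMap.mk φ hφ.continuous).comp u ∈ l.energyDomain p ∧
      l.energy p ((ContinuousMap.mk φ hφ.continuous).comp u) ≤ l.energy p u) ∧
    -- spectral gap
    (∃ C : ℝ, 1 ≤ C ∧ ∀ u ∈ l.energyDomain p,
      (∫ x, |u x - (⨍ y, u y ∂l.measure)| ^ p ∂l.measure) ≤
        C * Metric.diam l.carrier ^ (p - 1) * l.energy p u) ∧
    -- strong locality
    (∀ u ∈ l.energyDomain p, ∀ v ∈ l.energyDomain p,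
      (∃ a : ℝ, tsupport u ∩ tsupport (fun x => v x - a) = ∅) →
      l.energy p (u + v) = l.energy p u + l.energy p v) := by
  have hp : 1 < p := Fact.out
  exact ⟨VicsekScale.monotone_discreteEnergy hp, l.exists_energy_seminorm p, inferInstance,
    inferInstance, inferInstance,
    UniformConvexSpace.surjective_inclusionInDoubleDual (l.Sobolev p),
    fun u hu v hv => VicsekScale.mul_mem_energyDomain hu hv, l.dense_energyDomain p,
    fun u hu φ hφ => VicsekScale.comp_mem_energyDomain hu φ hφ, l.exists_spectral_gap p,
    fun u hu v hv ⟨a, ha⟩ => VicsekScale.energy_add_of_tsupport hu hv ha⟩
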